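/- Let $\mathcal X$ be a measurable space, $P(x,dy)$ a Markov transition kernel on $\mathcal X$, and $\pi$ a probability measure on $\mathcal X$. All sets and functions below are measurable. Write $P^t$ for the $t$-step kernel ($P^0(x,\cdot)=\delta_x$), $Pf(x)=\int f(y)\,P(x,dy)$, and $u_+=\max(u,0)$. Assume: (i) $P$ is reversible with respect to $\pi$, that is, $\pi(dx)P(x,dy)=\pi(dy)P(y,dx)$, and $P$ has nonnegative eigenvalues, that is, the spectrum of the operator $f\mapsto Pf$ on the real space $L^2(\pi)$ is contained in $[0,1]$; (ii) there are a set $C\subseteq\mathcal X$, a function $V:\mathcal X\to[1,\infty)$ and real constants $0<\lambda<1$ and $K$ such that $PV(x)\le\lambda V(x)$ for $x\notin C$ and $PV(x)\le K$ for $x\in C$; (iii) there are an integer $m\ge1$, a real number $\varepsilon>0$ and a probability measure $\nu$ on $\mathcal X$ such that $P^m(x,S)\ge\varepsilon\,\nu(S)$ for all $x\in C$ and all $S\subseteq\mathcal X$. Define $$B=\frac{1-\lambda^m}{1-\lambda}(K-\lambda)+\lambda^m .$$ If $\varepsilon=1$, let $\rho=\lambda$ and $r=1$. Otherwise let $$\rho=\max\left\{\lambda,\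 \exp\left(\frac{-\log(1-\varepsilon)\log\lambda}{-m\log\lambda+\log(B-\varepsilon)-\log(1-\varepsilon)}\right)\right\},\qquad r=\frac{\log\rho}{\log\lambda}.$$ Let $$D=\frac12\sqrt{\left[\frac{B-(1-\varepsilon)}{\varepsilon}\right]^r\frac{\rho^{2-m}}{1-\rho}},$$ $$F_0(x)=(1-D)_+\,\rho^{1-m}V(x)^r+D,\qquad F_1(x)=(1-\rho)\rho^{-m}D\,V(x)^r,\qquad G_0(x)=V(x)+\frac{K-\lambda}{1-\lambda}.$$ Then $\rho<1$, and for all $x\in\mathcal X$ and all integers $t\ge0$, $$\|P^t(x,\cdot)-\pi\|_{\mathrm{TV}}\le[F_1(x)t+F_0(x)]\,\rho^t,\qquad\text{where } \|\mu-\mu'\|_{\mathrm{TV}}=\sup_{S}|\mu(S)-\mu'(S)|.$$ Moreover $V$ is integrable with respect to $\pi$ and to every $P^t(x,\cdot)$, and the $V$-norm distance $\|\mu-\mu'\|_V=\sup_{|f|\le V}\left|\int f\,d\mu-\int f\,d\mu'\right|$ satisfies the following bounds. If $\rho=\lambda$, let $G_1(x)=K\lambda^{-1}[2F_0(x)-F_1(x)]$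 and $G_2(x)=K\lambda^{-1}F_1(x)$. Then for all $x\in\mathcal X$ and all integers $t\ge0$, $$\|P^t(x,\cdot)-\pi\|_V\le[G_2(x)t^2+G_1(x)t+G_0(x)]\,\lambda^t .$$ If $\rho>\lambda$, let $$H_0(x)=2K\left[\frac{F_0(x)}{\rho-\lambda}-\frac{\rho F_1(x)}{(\rho-\lambda)^2}\right],\qquad H_1(x)=\frac{2KF_1(x)}{\rho-\lambda}.$$ Then for all $x\in\mathcal X$ and all integers $t\ge0$, $$\|P^t(x,\cdot)-\pi\|_V\le[H_1(x)t+H_0(x)]\,\rho^t+[G_0(x)-H_0(x)]\,\lambda^t .$$ -/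

import Mathlib

open MeasureTheory ProbabilityTheory
open scoped ENNReal

namespace DriftMinorization

variable {X : Type*} [MeasurableSpace X]

/-! ### The transition operator on `L²(π)` -/

/-- `Pf(x) = ∫ f(y) P(x,dy)`. -/
noncomputable def kernelAct (P : Kernel X X) (f : X → ℝ) (x : X) : ℝ := ∫ y, f y ∂(P x)

lemma lintegral_lintegral_eq {P : Kernel X X} {π : Measure X} (h : Kernel.Invariant P π)
    {g : X → ℝ≥0∞} (hg : Measurable g) : ∫⁻ x, ∫⁻ y, g y ∂(P x) ∂π = ∫⁻ x, g x ∂π := by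
  conv_rhs => rw [← h.def]
  exact (Measure.lintegral_bind P.aemeasurable hg.aemeasurable).symm

lemma ae_ae_of_invariant {P : Kernel X X} {π : Measure X} (h : Kernel.Invariant P π)
    {p : X → Prop} (hp : ∀ᵐ x ∂π, p x) : ∀ᵐ x ∂π, ∀ᵐ y ∂(P x), p y := by
  rw [← h.def] at hp
  exact Measure.ae_ae_of_ae_comp hp

lemma kernelAct_congr {P : Kernel X X} {π : Measure X} (h : Kernel.Invariant P π)
    {f g : X → ℝ} (hfg : f =ᵐ[π] g) : kernelAct P f =ᵐ[π] kernelAct P g := by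
  filter_upwards [ae_ae_of_invariant h hfg] with x hx
  exact integral_congr_ae hx

lemma ae_integrable_of_invariant {P : Kernel X X} [IsMarkovKernel P] {π : Measure X}
    [IsProbabilityMeasure π] (h : Kernel.Invariant P π) (f : Lp ℝ 2 π) :
    ∀ᵐ x ∂π, Integrable f (P x) := by
  have hm : Measurable (f : X → ℝ) := (Lp.stronglyMeasurable f).measurable
  have hint : Integrable f π := (Lp.memLp f).integrable (by norm_num)
  have hfin : ∫⁻ x, ∫⁻ y, ‖f y‖ₑ ∂(P x) ∂π ≠ ∞ := by
    rw [lintegral_lintegral_eq h hm.enorm]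
    exact hint.hasFiniteIntegral.ne
  filter_upwards [ae_lt_top hm.enorm.lintegral_kernel hfin] with x hx
  exact ⟨hm.aestronglyMeasurable, hx⟩

lemma eLpNorm_kernelAct_le {P : Kernel X X} [IsMarkovKernel P] {π : Measure X}
    (h : Kernel.Invariant P π) {f : X → ℝ} (hm : StronglyMeasurable f) :
    eLpNorm (kernelAct P f) 2 π ≤ eLpNorm f 2 π := by
  have key (g : X → ℝ) (μ : Measure X) :
      eLpNorm g 2 μ = (∫⁻ x, ‖g x‖ₑ ^ (2 : ℝ) ∂μ) ^ (1 / (2 : ℝ)) := by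
    rw [eLpNorm_eq_lintegral_rpow_enorm_toReal (by norm_num) (by norm_num)]
    norm_num
  rw [key, key]
  refine ENNReal.rpow_le_rpow ?_ (by norm_num)
  rw [← lintegral_lintegral_eq h (g := fun x => ‖f x‖ₑ ^ (2 : ℝ))
    (hm.measurable.enorm.pow_const _)]
  refine lintegral_mono fun x => ?_
  have h1 : ‖kernelAct P f x‖ₑ ≤ eLpNorm f 2 (P x) := by
    refine (enorm_integral_le_lintegral_enorm _).trans ?_
    rw [← eLpNorm_one_eq_lintegral_enorm]
    exact eLpNorm_le_eLpNorm_of_exponent_le (by norm_num) hm.aestronglyMeasurable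
  rw [key] at h1
  calc ‖kernelAct P f x‖ₑ ^ (2 : ℝ)
      ≤ ((∫⁻ y, ‖f y‖ₑ ^ (2 : ℝ) ∂(P x)) ^ (1 / (2 : ℝ))) ^ (2 : ℝ) := by gcongr
    _ = ∫⁻ y, ‖f y‖ₑ ^ (2 : ℝ) ∂(P x) := by
      rw [← ENNReal.rpow_mul]; norm_num

lemma memLp_kernelAct {P : Kernel X X} [IsMarkovKernel P] {π : Measure X}
    (h : Kernel.Invariant P π) (f : Lp ℝ 2 π) : MemLp (kernelAct P f) 2 π :=
  ⟨(StronglyMeasurable.integral_kernel (Lp.stronglyMeasurable f)).aestronglyMeasurable,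
    (eLpNorm_kernelAct_le h (Lp.stronglyMeasurable f)).trans_lt (Lp.memLp f).2⟩

/-- The transition kernel as the bounded operator `f ↦ Pf` on the real Hilbert space `L²(π)`,
where `π` is stationary for `P`. -/
noncomputable def transitionOperator (P : Kernel X X) [IsMarkovKernel P] (π : Measure X)
    [IsProbabilityMeasure π] (h : Kernel.Invariant P π) : Lp ℝ 2 π →L[ℝ] Lp ℝ 2 π :=
  LinearMap.mkContinuous
    { toFun := fun f => (memLp_kernelAct h f).toLp (kernelAct P f)
      map_add' := fun f g => by
        rw [← MemLp.toLp_add]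
        refine MemLp.toLp_congr _ _ ?_
        filter_upwards [kernelAct_congr h (Lp.coeFn_add f g), ae_integrable_of_invariant h f,
          ae_integrable_of_invariant h g] with x hx hf hg
        rw [hx]
        exact integral_add hf hg
      map_smul' := fun c f => by
        rw [RingHom.id_apply, ← MemLp.toLp_const_smul]
        refine MemLp.toLp_congr _ _ ?_
        filter_upwards [kernelAct_congr h (Lp.coeFn_smul c f)] with x hx
        rw [hx]
        exact integral_smul c _ }
    1
    (fun f => by
      rw [one_mul]
      change ‖(memLp_kernelAct h f).toLp (kernelAct P f)‖ ≤ ‖f‖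
      rw [Lp.norm_toLp, Lp.norm_def]
      exact ENNReal.toReal_mono (Lp.memLp f).2.ne
        (eLpNorm_kernelAct_le h (Lp.stronglyMeasurable f)))

lemma transitionOperator_ae_eq (P : Kernel X X) [IsMarkovKernel P] (π : Measure X)
    [IsProbabilityMeasure π] (h : Kernel.Invariant P π) (f : Lp ℝ 2 π) :
    transitionOperator P π h f =ᵐ[π] fun x => ∫ y, f y ∂(P x) :=
  MemLp.coeFn_toLp (memLp_kernelAct h f)

/-- `P`, reversible with respect to `π`, has nonnegative eigenvalues: the `L²(π)` spectrum of the
self-adjoint operator `f ↦ Pf` is contained in `[0,1]`. -/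
def HasNonnegEigenvalues (P : Kernel X X) [IsMarkovKernel P] (π : Measure X)
    [IsProbabilityMeasure π] (hrev : Kernel.IsReversible P π) : Prop :=
  spectrum ℝ (transitionOperator P π hrev.invariant) ⊆ Set.Icc 0 1

/-! ### Drift functions and small sets -/

/-- `V : X → [1,∞)` is a drift function for `P` with respect to `C`, with constants `lam < 1` and
`K`: one has `PV ≤ lam * V` off `C` and `PV ≤ K` on `C`. -/
structure IsDriftFunction (P : Kernel X X) (C : Set X) (V : X → ℝ) (lam K : ℝ) : Prop where
  measurable : Measurable V
  one_le : ∀ x, 1 ≤ V x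
  lam_lt_one : lam < 1
  drift : ∀ x, x ∉ C → ∫⁻ y, ENNReal.ofReal (V y) ∂(P x) ≤ ENNReal.ofReal (lam * V x)
  bound : ∀ x, x ∈ C → ∫⁻ y, ENNReal.ofReal (V y) ∂(P x) ≤ ENNReal.ofReal K

/-- `C` is a small set for `P`, with `m`-step minorization `P^m(x,·) ≥ ε ν` for `x ∈ C`. -/
structure IsSmallSet (P : Kernel X X) (C : Set X) (ν : Measure X) (m : ℕ) (ε : ℝ) : Prop where
  measurableSet : MeasurableSet C
  isProbabilityMeasure : IsProbabilityMeasure ν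
  one_le_m : 1 ≤ m
  eps_pos : 0 < ε
  minorization : ∀ x ∈ C, ∀ S, MeasurableSet S → ENNReal.ofReal ε * ν S ≤ (P ^ m) x S

/-! ### Distances between probability measures -/

/-- Total variation distance `sup_S |μ(S) - μ'(S)|`, over measurable `S`. -/
noncomputable def tvDist (μ μ' : Measure X) : ℝ :=
  ⨆ S : {S : Set X // MeasurableSet S}, |μ.real S - μ'.real S|

/-- `V`-norm distance `sup_{|f| ≤ V} |μ(f) - μ'(f)|`, over measurable `f`, with values in the
extended reals. -/
noncomputable def vDist (V : X → ℝ) (μ μ' : Measure X) : EReal :=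
  ⨆ f : {f : X → ℝ // Measurable f ∧ ∀ x, |f x| ≤ V x},
    ((|∫ x, f.1 x ∂μ - ∫ x, f.1 x ∂μ'| : ℝ) : EReal)

/-! ### The explicit constants and functions -/

noncomputable def B (lam K : ℝ) (m : ℕ) : ℝ :=
  (1 - lam ^ m) / (1 - lam) * (K - lam) + lam ^ m

noncomputable def rho (lam K : ℝ) (m : ℕ) (ε : ℝ) : ℝ :=
  if ε = 1 then lam
  else max lam (Real.exp ((-Real.log (1 - ε) * Real.log lam) /
    (-(m : ℝ) * Real.log lam + Real.log (B lam K m - ε) - Real.log (1 - ε))))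

noncomputable def r (lam K : ℝ) (m : ℕ) (ε : ℝ) : ℝ :=
  if ε = 1 then 1 else Real.log (rho lam K m ε) / Real.log lam

noncomputable def D (lam K : ℝ) (m : ℕ) (ε : ℝ) : ℝ :=
  1 / 2 * Real.sqrt (((B lam K m - (1 - ε)) / ε) ^ r lam K m ε *
    (rho lam K m ε ^ (2 - (m : ℤ)) / (1 - rho lam K m ε)))

noncomputable def F₀ (V : X → ℝ) (lam K : ℝ) (m : ℕ) (ε : ℝ) (x : X) : ℝ :=
  max (1 - D lam K m ε) 0 * rho lam K m ε ^ (1 - (m : ℤ)) * V x ^ r lam K m ε + D lam K m ε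

noncomputable def F₁ (V : X → ℝ) (lam K : ℝ) (m : ℕ) (ε : ℝ) (x : X) : ℝ :=
  (1 - rho lam K m ε) * rho lam K m ε ^ (-(m : ℤ)) * D lam K m ε * V x ^ r lam K m ε

noncomputable def G₀ (V : X → ℝ) (lam K : ℝ) (x : X) : ℝ :=
  V x + (K - lam) / (1 - lam)

noncomputable def G₁ (V : X → ℝ) (lam K : ℝ) (m : ℕ) (ε : ℝ) (x : X) : ℝ :=
  K * lam⁻¹ * (2 * F₀ V lam K m ε x - F₁ V lam K m ε x)

noncomputable def G₂ (V : X → ℝ) (lam K : ℝ) (m : ℕ) (ε : ℝ) (x : X) : ℝ :=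
  K * lam⁻¹ * F₁ V lam K m ε x

noncomputable def H₀ (V : X → ℝ) (lam K : ℝ) (m : ℕ) (ε : ℝ) (x : X) : ℝ :=
  2 * K * (F₀ V lam K m ε x / (rho lam K m ε - lam) -
    rho lam K m ε * F₁ V lam K m ε x / (rho lam K m ε - lam) ^ 2)

noncomputable def H₁ (V : X → ℝ) (lam K : ℝ) (m : ℕ) (ε : ℝ) (x : X) : ℝ :=
  2 * K * F₁ V lam K m ε x / (rho lam K m ε - lam)

end DriftMinorization

/-! The minorization lets the chain regenerate: `m` steps from a point of `C` end in law `ν` with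
probability `ε`, and otherwise follow the residual measure `P^m(x,·) - εν`. Let `q t` be the
probability that the first regeneration takes more than `t` steps. No split chain is built; `tail`
defines these probabilities by recursion, and only the inequality `sum_tail_sub_mul_le`, which keeps
the paths that have regenerated, is used.

Geometric tails. By Jensen, `V^r` contracts by `λ^r = ρ` off `C`, and `ρ` is chosen so that the
residual integral of `V^r` on `C` is at most `ρ^m`. Hence `q` decays like `ρ^t`
(`tail_le_rho_zpow_mul`).

Start from `ν`. Let `h = dν/dπ` and `b k = ⟨h, P^k h⟩`. Spectrum in `[0,1]` makes `b` decrease, and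
its limit is `1`. With `q` the tails from `ν`, regeneration gives `∑ (q s - q (s+1)) b (t-1-s) ≤ b
t`. After summation by parts, multiplication by `z^t` and summation over `t`, the generating
function of `q` appears on both sides and cancels, leaving `∑ (b k - b (k+1)) ρ^(-k-1) ≤ b 0`. So
`b` converges at the rate of the tails (`sub_one_le_of_renewal`). By reversibility `νP^k` has
density `P^k h`, of squared norm `b (2k)`, and Cauchy–Schwarz bounds its total variation distance to
`π` by `D ρ^k`.

A general start is decomposed at its first regeneration (`abs_kernelAct_pow_sub_le`). The drift
condition then lifts total variation bounds to the `V`-norm through a linear recursion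
(`abs_integral_pow_sub_le_of_recursion`). -/

namespace DriftMinorization

/-- Bounded measurable real functions. -/
def BddMeas {X : Type*} [MeasurableSpace X] (f : X → ℝ) : Prop :=
  Measurable f ∧ ∃ M, ∀ x, |f x| ≤ M

/-! ### Bounded measurable functions and iterated kernels. -/

section Basics

variable {X : Type*} [MeasurableSpace X]

lemma BddMeas.integrable {f : X → ℝ} (hf : BddMeas f) (μ : Measure X) [IsFiniteMeasure μ] :
    Integrable f μ := by
  obtain ⟨M, hM⟩ := hf.2
  exact Integrable.of_bound hf.1.aestronglyMeasurable M (.of_forall hM)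

lemma BddMeas.of_mem_Icc {f : X → ℝ} (hm : Measurable f) {a b : ℝ} (h : ∀ x, f x ∈ Set.Icc a b) :
    BddMeas f :=
  ⟨hm, max |a| |b|, fun x => abs_le_max_abs_abs (h x).1 (h x).2⟩

lemma BddMeas.const (c : ℝ) : BddMeas (fun _ : X => c) := ⟨measurable_const, |c|, fun _ => le_rfl⟩

lemma BddMeas.add {f g : X → ℝ} (hf : BddMeas f) (hg : BddMeas g) :
    BddMeas (fun x => f x + g x) := by
  obtain ⟨hf, M, hM⟩ := hf
  obtain ⟨hg, N, hN⟩ := hg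
  exact ⟨hf.add hg, M + N, fun x => (abs_add_le _ _).trans (add_le_add (hM x) (hN x))⟩

lemma BddMeas.mul {f g : X → ℝ} (hf : BddMeas f) (hg : BddMeas g) :
    BddMeas (fun x => f x * g x) := by
  obtain ⟨hf, M, hM⟩ := hf
  obtain ⟨hg, N, hN⟩ := hg
  refine ⟨hf.mul hg, M * N, fun x => ?_⟩
  rw [abs_mul]
  exact mul_le_mul (hM x) (hN x) (abs_nonneg _) ((abs_nonneg _).trans (hM x))

lemma BddMeas.sub {f g : X → ℝ} (hf : BddMeas f) (hg : BddMeas g) :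
    BddMeas (fun x => f x - g x) := by
  have := hf.add ((BddMeas.const (-1)).mul hg)
  convert this using 2
  ring

lemma BddMeas.memLp {f : X → ℝ} (hf : BddMeas f) (μ : Measure X) [IsFiniteMeasure μ] :
    MemLp f 2 μ := by
  obtain ⟨M, hM⟩ := hf.2
  exact MemLp.of_bound hf.1.aestronglyMeasurable M (.of_forall hM)

instance isMarkovKernel_pow (P : Kernel X X) [IsMarkovKernel P] (t : ℕ) :
    IsMarkovKernel (P ^ t) := by
  induction t with
  | zero => rw [pow_zero]; exact inferInstanceAs (IsMarkovKernel Kernel.id)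
  | succ t ih => rw [Kernel.pow_add, pow_one]; infer_instance

lemma BddMeas.kernelAct {P : Kernel X X} [IsMarkovKernel P] {f : X → ℝ} (hf : BddMeas f) :
    BddMeas (kernelAct P f) := by
  obtain ⟨M, hM⟩ := hf.2
  refine ⟨(StronglyMeasurable.integral_kernel hf.1.stronglyMeasurable).measurable, M, fun x => ?_⟩
  have := norm_integral_le_of_norm_le_const (μ := P x) (f := f) (C := M) (.of_forall hM)
  simpa [DriftMinorization.kernelAct] using this

lemma kernelAct_pow_zero (P : Kernel X X) {f : X → ℝ} (hf : Measurable f) :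
    kernelAct (P ^ 0) f = f := by
  funext x
  simp only [kernelAct, pow_zero]
  change ∫ y, f y ∂(Kernel.id x) = f x
  rw [Kernel.id_apply, integral_dirac' _ _ hf.stronglyMeasurable]

lemma kernelAct_pow_add (P : Kernel X X) (s t : ℕ) {f : X → ℝ} {x : X}
    (hf : Integrable f ((P ^ (s + t)) x)) :
    kernelAct (P ^ (s + t)) f x = ∫ y, kernelAct (P ^ t) f y ∂((P ^ s) x) := by
  -- In a composition the right factor acts first, so the sum is flipped to run the `s` steps first.
  rw [add_comm, Kernel.pow_add] at hf
  rw [kernelAct, add_comm, Kernel.pow_add, Kernel.integral_comp hf]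
  rfl

lemma kernelAct_pow_succ (P : Kernel X X) (t : ℕ) {f : X → ℝ} {x : X}
    (hf : Integrable f ((P ^ (t + 1)) x)) :
    kernelAct (P ^ (t + 1)) f x = ∫ y, kernelAct (P ^ t) f y ∂(P x) := by
  rw [add_comm] at hf ⊢
  rw [kernelAct_pow_add P 1 t hf, pow_one]

lemma kernelAct_pow_succ' (P : Kernel X X) (t : ℕ) {f : X → ℝ} {x : X}
    (hf : Integrable f ((P ^ (t + 1)) x)) :
    kernelAct (P ^ (t + 1)) f x = kernelAct (P ^ t) (kernelAct P f) x := by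
  rw [kernelAct_pow_add P t 1 hf, pow_one]
  rfl

lemma lintegral_pow_succ (P : Kernel X X) (t : ℕ) {f : X → ℝ≥0∞} (hf : Measurable f) (x : X) :
    ∫⁻ y, f y ∂((P ^ (t + 1)) x) = ∫⁻ y, ∫⁻ z, f z ∂((P ^ t) y) ∂(P x) := by
  rw [Kernel.pow_add, pow_one, Kernel.lintegral_comp _ _ _ hf]

lemma invariant_pow {P : Kernel X X} {π : Measure X} (h : Kernel.Invariant P π) (t : ℕ) :
    Kernel.Invariant (P ^ t) π := by
  induction t with
  | zero =>
    rw [pow_zero]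
    exact Measure.bind_dirac
  | succ t ih =>
    rw [Kernel.pow_add, pow_one]
    exact ih.comp h

lemma integral_kernelAct {P : Kernel X X} [IsMarkovKernel P] {π : Measure X} [IsFiniteMeasure π]
    (h : Kernel.Invariant P π) {f : X → ℝ} (hf : Integrable f π) :
    ∫ x, kernelAct P f x ∂π = ∫ x, f x ∂π := by
  -- Viewing `π` as a kernel from `Unit` makes Fubini for compositions available for signed `f`.
  have hf' : Integrable f ((P ∘ₖ Kernel.const Unit π) ()) := by
    rwa [← Measure.comp_eq_comp_const_apply, h.def]
  have := Kernel.integral_comp hf'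
  rw [← Measure.comp_eq_comp_const_apply, h.def] at this
  exact this.symm

end Basics

/-! ### The renewal inequality and its generating functions. -/

section Sequences

open Finset Filter Topology

/-- Summation by parts: it moves differences off `q`, for which only upper bounds are known, onto
`b`. -/
lemma sum_range_sub_mul_reflect (q b : ℕ → ℝ) (t : ℕ) :
    ∑ s ∈ range t, (q s - q (s + 1)) * b (t - 1 - s) =
      q 0 * b t + ∑ s ∈ range t, q s * (b (t - 1 - s) - b (t - s)) - q t * b 0 := by
  have h1 := sum_range_succ (fun s => q s * b (t - s)) t
  have h2 := sum_range_succ' (fun s => q s * b (t - s)) t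
  have h3 : ∑ s ∈ range t, q (s + 1) * b (t - (s + 1)) =
      ∑ s ∈ range t, q (s + 1) * b (t - 1 - s) :=
    sum_congr rfl fun s _ => by rw [Nat.sub_add_eq, Nat.sub_right_comm]
  rw [Nat.sub_self] at h1
  rw [Nat.sub_zero] at h2
  simp only [sub_mul, mul_sub, sum_sub_distrib]
  linarith

/-- Finite form of the product of two generating functions with nonnegative coefficients. -/
lemma sum_range_mul_sum_range_le {q d : ℕ → ℝ} (hq : ∀ n, 0 ≤ q n) (hd : ∀ n, 0 ≤ d n)
    {b : ℝ} (h : ∀ t, ∑ s ∈ range t, q s * d (t - 1 - s) ≤ q t * b) {z : ℝ} (hz : 0 ≤ z)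
    (J N : ℕ) :
    (∑ s ∈ range N, q s * z ^ s) * ∑ k ∈ range J, d k * z ^ (k + 1) ≤
      b * ∑ t ∈ range (N + J), q t * z ^ t := by
  classical
  calc (∑ s ∈ range N, q s * z ^ s) * ∑ k ∈ range J, d k * z ^ (k + 1)
      = ∑ p ∈ range N ×ˢ range J, q p.1 * d p.2 * z ^ (p.1 + p.2 + 1) := by
        rw [sum_mul_sum, sum_product]
        refine sum_congr rfl fun s _ => sum_congr rfl fun k _ => ?_
        ring
    -- Reindex by `t = s + k + 1`, keeping `s`; the rectangle becomes part of the triangle `s < t <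
    -- N + J`, whose other terms are nonnegative.
    _ = ∑ p ∈ (range N ×ˢ range J).image (fun p : ℕ × ℕ => (⟨p.1 + p.2 + 1, p.1⟩ : Σ _ : ℕ, ℕ)),
          q p.2 * d (p.1 - 1 - p.2) * z ^ p.1 := by
        rw [sum_image]
        · refine sum_congr rfl fun p _ => ?_
          have : p.1 + p.2 + 1 - 1 - p.1 = p.2 := by omega
          simp only [this]
        · rintro ⟨a, b⟩ _ ⟨c, e⟩ _ hh
          simp only [Sigma.mk.injEq, heq_eq_eq, Prod.mk.injEq] at hh ⊢
          omega
    _ ≤ ∑ p ∈ (range (N + J)).sigma (fun t => range t), q p.2 * d (p.1 - 1 - p.2) * z ^ p.1 := by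
        refine sum_le_sum_of_subset_of_nonneg ?_ ?_
        · intro p hp
          simp only [mem_image, mem_product, mem_range, mem_sigma, Prod.exists] at hp ⊢
          obtain ⟨a, b, ⟨ha, hb⟩, rfl⟩ := hp
          dsimp only
          omega
        · intro p _ _
          have := hq p.2
          have := hd (p.1 - 1 - p.2)
          positivity
    _ = ∑ t ∈ range (N + J), (∑ s ∈ range t, q s * d (t - 1 - s)) * z ^ t := by
        rw [sum_sigma]
        simp only [sum_mul]
    _ ≤ ∑ t ∈ range (N + J), q t * b * z ^ t :=
        sum_le_sum fun t _ => mul_le_mul_of_nonneg_right (h t) (by positivity)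
    _ = b * ∑ t ∈ range (N + J), q t * z ^ t := by
        rw [mul_sum]
        exact sum_congr rfl fun t _ => by ring

/-- For `z < 1/rho` the series of `q` converges, and it is positive because `q 0 = 1`. Letting `N →
∞` in the product inequality, it divides out. The endpoint `z = 1/rho` is reached by continuity of a
polynomial in `z`. -/
lemma sum_range_mul_pow_le {q d : ℕ → ℝ} (hq : ∀ n, 0 ≤ q n) (hd : ∀ n, 0 ≤ d n)
    (hq0 : q 0 = 1) {b : ℝ} (h : ∀ t, ∑ s ∈ range t, q s * d (t - 1 - s) ≤ q t * b)
    {c rho : ℝ} (hrho : 0 < rho) (hqc : ∀ n, q n ≤ c * rho ^ n) (J : ℕ) :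
    ∑ k ∈ range J, d k * rho⁻¹ ^ (k + 1) ≤ b := by
  have key : ∀ z ∈ Set.Ioo 0 rho⁻¹, ∑ k ∈ range J, d k * z ^ (k + 1) ≤ b := by
    rintro z ⟨hz0, hz1⟩
    have hz2 : rho * z < 1 := by
      calc rho * z < rho * rho⁻¹ := by gcongr
        _ = 1 := mul_inv_cancel₀ hrho.ne'
    have hsum : Summable fun s => q s * z ^ s := by
      refine Summable.of_nonneg_of_le (fun s => by have := hq s; positivity) (fun s => ?_)
        ((summable_geometric_of_lt_one (by positivity) hz2).mul_left c)
      rw [mul_pow, ← mul_assoc]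
      exact mul_le_mul_of_nonneg_right (hqc s) (by positivity)
    have hlim := hsum.hasSum.tendsto_sum_nat
    have hpos : 0 < ∑' s, q s * z ^ s := by
      refine hsum.tsum_pos (fun s => by have := hq s; positivity) 0 ?_
      simp [hq0]
    have := le_of_tendsto_of_tendsto' (hlim.mul_const _)
      ((hlim.comp (tendsto_add_atTop_nat J)).const_mul b)
      (fun N => sum_range_mul_sum_range_le hq hd h hz0.le J N)
    rw [mul_comm] at this
    exact le_of_mul_le_mul_right this hpos
  have hc : Tendsto (fun z : ℝ => ∑ k ∈ range J, d k * z ^ (k + 1)) (𝓝[<] rho⁻¹)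
      (𝓝 (∑ k ∈ range J, d k * rho⁻¹ ^ (k + 1))) := by
    have : Continuous fun z : ℝ => ∑ k ∈ range J, d k * z ^ (k + 1) := by fun_prop
    exact this.continuousAt.tendsto.mono_left nhdsWithin_le_nhds
  exact le_of_tendsto hc (Filter.eventually_of_mem (Ioo_mem_nhdsLT (by positivity)) key)

/-- A renewal inequality with geometric tails forces geometric convergence of a monotone
sequence, at the rate of the tails. -/
lemma sub_one_le_of_renewal {q b : ℕ → ℝ} (hq : ∀ n, 0 ≤ q n) (hq0 : q 0 = 1)
    (hb : Antitone b) (hlim : Tendsto b atTop (𝓝 1))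
    (h : ∀ t, ∑ s ∈ range t, (q s - q (s + 1)) * b (t - 1 - s) ≤ b t)
    {c rho : ℝ} (hrho : 0 < rho) (hrho1 : rho < 1) (hqc : ∀ n, q n ≤ c * rho ^ n) (n : ℕ) :
    b n - 1 ≤ rho ^ n * (rho / (1 - rho)) := by
  set d : ℕ → ℝ := fun k => b k - b (k + 1) with hd_def
  have hd : ∀ k, 0 ≤ d k := fun k => sub_nonneg.2 (hb (Nat.le_succ k))
  have h' : ∀ t, ∑ s ∈ range t, q s * d (t - 1 - s) ≤ q t * b 0 := by
    intro t
    have h1 := h t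
    rw [sum_range_sub_mul_reflect, hq0] at h1
    have : ∑ s ∈ range t, q s * d (t - 1 - s) =
        ∑ s ∈ range t, q s * (b (t - 1 - s) - b (t - s)) := by
      refine sum_congr rfl fun s hs => ?_
      have : t - 1 - s + 1 = t - s := by have := mem_range.1 hs; omega
      simp only [hd_def, this]
    linarith
  have hz1 : 1 ≤ rho⁻¹ := (one_le_inv₀ hrho).2 hrho1.le
  -- Subtracting the telescoping sum of `d` replaces the bound `b 0` by `b (n + N)`, which tends to
  -- `1`. Only the indices from `n` on are kept, where the weight is at least `rho⁻¹ ^ (n + 1) - 1`.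
  have hfin : ∀ N, (b n - b (n + N)) * (rho⁻¹ ^ (n + 1) - 1) ≤ b (n + N) := by
    intro N
    have h1 := sum_range_mul_pow_le hq hd hq0 h' hrho hqc (n + N)
    have h2 : ∑ k ∈ range (n + N), d k = b 0 - b (n + N) := sum_range_sub' b (n + N)
    have h3 : ∑ k ∈ range (n + N), d k * (rho⁻¹ ^ (k + 1) - 1) ≤ b (n + N) := by
      simp only [mul_sub, mul_one, sum_sub_distrib]
      linarith
    refine le_trans ?_ h3
    rw [sum_range_add]
    have h4 : ∑ k ∈ range N, d (n + k) = b n - b (n + N) := by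
      simpa [hd_def, add_assoc] using sum_range_sub' (fun k => b (n + k)) N
    have h5 : 0 ≤ ∑ k ∈ range n, d k * (rho⁻¹ ^ (k + 1) - 1) :=
      sum_nonneg fun k _ => mul_nonneg (hd k) (sub_nonneg.2 (one_le_pow₀ hz1))
    refine le_add_of_nonneg_of_le h5 ?_
    rw [← h4, sum_mul]
    refine sum_le_sum fun k _ => mul_le_mul_of_nonneg_left ?_ (hd _)
    have : rho⁻¹ ^ (n + 1) ≤ rho⁻¹ ^ (n + k + 1) := pow_le_pow_right₀ hz1 (by omega)
    linarith
  have hl : Tendsto (fun N => b (n + N)) atTop (𝓝 1) := by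
    simpa [Function.comp_def, add_comm] using hlim.comp (tendsto_add_atTop_nat n)
  have hle : (b n - 1) * (rho⁻¹ ^ (n + 1) - 1) ≤ 1 :=
    le_of_tendsto_of_tendsto' ((hl.const_sub _).mul_const _) hl hfin
  have hp : rho ^ (n + 1) ≤ rho := pow_le_of_le_one hrho.le hrho1.le (by omega)
  have hp0 : 0 < rho ^ (n + 1) := by positivity
  have hb1 : 0 ≤ b n - 1 := sub_nonneg.2 (hb.le_of_tendsto hlim n)
  rw [inv_pow] at hle
  have h6 : (b n - 1) * (1 - rho ^ (n + 1)) ≤ rho ^ (n + 1) := by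
    calc (b n - 1) * (1 - rho ^ (n + 1))
        = ((b n - 1) * ((rho ^ (n + 1))⁻¹ - 1)) * rho ^ (n + 1) := by
          field_simp
      _ ≤ 1 * rho ^ (n + 1) := by gcongr
      _ = rho ^ (n + 1) := one_mul _
  rw [← mul_div_assoc, le_div_iff₀ (by linarith), ← pow_succ]
  refine le_trans ?_ h6
  gcongr

end Sequences

/-! ### Self-adjoint operators with spectrum in `[0,1]`. -/

section Hilbert

variable {E : Type*} [NormedAddCommGroup E] [InnerProductSpace ℝ E] [CompleteSpace E]

/-- The spectrum of `1 - A` lies in `[0,1]` too, and a self-adjoint operator has norm equal to its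
spectral radius, so `‖1 - A‖ ≤ 1` and `⟨(1 - A)x, x⟩ ≤ ‖x‖²`. -/
lemma inner_apply_self_nonneg_of_spectrum {A : E →L[ℝ] E} (hA : IsSelfAdjoint A)
    (hs : spectrum ℝ A ⊆ Set.Icc 0 1) (x : E) : 0 ≤ inner ℝ (A x) x := by
  have h1 : IsSelfAdjoint (1 - A) := (IsSelfAdjoint.one _).sub hA
  have h2 : spectralRadius ℝ (1 - A) ≤ 1 := by
    refine iSup₂_le fun k hk => ?_
    have hk' : 1 - k ∈ spectrum ℝ A := by
      rw [spectrum.mem_iff] at hk ⊢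
      intro h
      apply hk
      have : algebraMap ℝ (E →L[ℝ] E) k - (1 - A) =
          -(algebraMap ℝ (E →L[ℝ] E) (1 - k) - A) := by
        rw [map_sub, map_one]; abel
      rw [this]
      exact h.neg
    have := hs hk'
    rw [Set.mem_Icc] at this
    have h3 : ‖k‖₊ ≤ 1 := by
      rw [← NNReal.coe_le_coe, coe_nnnorm, Real.norm_eq_abs, NNReal.coe_one, abs_le]
      constructor <;> linarith
    exact_mod_cast h3
  have h3 : ‖1 - A‖ ≤ 1 := by
    have h := ContinuousLinearMap.spectralRadius_eq_nnnorm (𝕜 := ℝ) (T := 1 - A) h1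
    rw [h] at h2
    exact_mod_cast h2
  have h4 : inner ℝ ((1 - A) x) x ≤ ‖x‖ * ‖x‖ := by
    refine (real_inner_le_norm _ _).trans ?_
    gcongr
    exact ((1 - A).le_opNorm x).trans (by nlinarith [norm_nonneg x])
  simp only [sub_apply, one_apply_eq_self, inner_sub_left,
    real_inner_self_eq_norm_mul_norm] at h4
  linarith

/-- This is `A² ≤ A` without a square root of `A`: expand positivity at `x - A x` and bound `⟨A²x,
Ax⟩` by `‖Ax‖²`. -/
lemma norm_sq_apply_le_inner {A : E →L[ℝ] E} (hA : IsSelfAdjoint A)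
    (hpos : ∀ x, 0 ≤ inner ℝ (A x) x) (hn : ‖A‖ ≤ 1) (x : E) :
    inner ℝ (A x) (A x) ≤ inner ℝ (A x) x := by
  have hsym : ∀ u v, inner ℝ (A u) v = inner ℝ u (A v) := fun u v => hA.isSymmetric u v
  have h1 := hpos (x - A x)
  have h2 : inner ℝ (A (A x)) (A x) ≤ inner ℝ (A x) (A x) := by
    refine (real_inner_le_norm _ _).trans ?_
    rw [real_inner_self_eq_norm_mul_norm]
    gcongr
    exact (A.le_opNorm _).trans (by nlinarith [norm_nonneg (A x)])
  rw [map_sub, inner_sub_left, inner_sub_right, inner_sub_right, hsym (A x) x] at h1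
  linarith

/-- Split the powers evenly between both sides, with `y = A^j x`. Even `k` reduces to `⟨y, Ay⟩ ≤
‖y‖²`, odd `k` to `‖Ay‖² ≤ ⟨Ay, y⟩`. -/
lemma inner_pow_succ_le {A : E →L[ℝ] E} (hA : IsSelfAdjoint A)
    (hs : spectrum ℝ A ⊆ Set.Icc 0 1) (hn : ‖A‖ ≤ 1) (x : E) (k : ℕ) :
    inner ℝ x ((A ^ (k + 1)) x) ≤ inner ℝ x ((A ^ k) x) := by
  have hpos := inner_apply_self_nonneg_of_spectrum hA hs
  have hsym : ∀ (j : ℕ) (u v : E), inner ℝ u ((A ^ j) v) = inner ℝ ((A ^ j) u) v :=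
    fun j u v => ((hA.pow j).isSymmetric u v).symm
  have e1 : ∀ (j : ℕ) (u : E), (A ^ (j + 1)) u = A ((A ^ j) u) := fun j u => by
    rw [pow_succ']; rfl
  have e2 : ∀ (i j : ℕ) (u : E), (A ^ (i + j)) u = (A ^ i) ((A ^ j) u) := fun i j u => by
    rw [pow_add]; rfl
  rcases Nat.even_or_odd' k with ⟨j, rfl | rfl⟩
  · rw [show 2 * j + 1 = j + (j + 1) by ring, two_mul, e2 j (j + 1), e2 j j, hsym j x,
      hsym j x, e1 j]
    refine (real_inner_le_norm _ _).trans ?_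
    rw [real_inner_self_eq_norm_mul_norm]
    gcongr
    exact (A.le_opNorm _).trans (by nlinarith [norm_nonneg ((A ^ j) x)])
  · rw [show 2 * j + 1 + 1 = (j + 1) + (j + 1) by ring, show 2 * j + 1 = (j + 1) + j by ring,
      e2 (j + 1) (j + 1), e2 (j + 1) j, hsym (j + 1) x, hsym (j + 1) x, e1 j]
    exact norm_sq_apply_le_inner hA hpos hn _

end Hilbert

/-! ### Reversibility as self-adjointness, and comparison with `L²` distance. -/

section Reversible

lemma inner_toLp {X : Type*} [MeasurableSpace X] {π : Measure X} {f g : X → ℝ}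
    (hf : MemLp f 2 π) (hg : MemLp g 2 π) :
    inner ℝ (hf.toLp f) (hg.toLp g) = ∫ x, f x * g x ∂π := by
  rw [L2.inner_def]
  refine integral_congr_ae ?_
  filter_upwards [hf.coeFn_toLp, hg.coeFn_toLp] with x h1 h2
  rw [h1, h2]
  exact mul_comm _ _

variable {X : Type*} [MeasurableSpace X] {P : Kernel X X} [IsMarkovKernel P] {π : Measure X}
  [IsProbabilityMeasure π]

/-- Detailed balance says that the joint law of two consecutive stationary states is symmetric;
rectangles determine it. -/
lemma map_swap_compProd_of_isReversible (hrev : Kernel.IsReversible P π) :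
    (π ⊗ₘ P).map Prod.swap = π ⊗ₘ P := by
  refine Measure.ext_prod fun {s t} hs ht => ?_
  rw [Measure.map_apply measurable_swap (hs.prod ht), Set.preimage_swap_prod,
    Measure.compProd_apply_prod ht hs, Measure.compProd_apply_prod hs ht]
  exact hrev ht hs

lemma integral_mul_kernelAct_comm (hrev : Kernel.IsReversible P π) {f g : X → ℝ}
    (hf : MemLp f 2 π) (hg : MemLp g 2 π) :
    ∫ x, f x * kernelAct P g x ∂π = ∫ x, kernelAct P f x * g x ∂π := by
  -- Both marginals of the joint law are `π`, so functions of either coordinate stay in `L²` and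
  -- their products are integrable.
  have hfst : ∀ {u : X → ℝ}, MemLp u 2 π → MemLp (fun p : X × X => u p.1) 2 (π ⊗ₘ P) := by
    intro u hu
    have : MemLp u 2 ((π ⊗ₘ P).map Prod.fst) := by
      rw [← Measure.fst, Measure.fst_compProd]; exact hu
    exact this.comp_of_map measurable_fst.aemeasurable
  have hsnd : ∀ {u : X → ℝ}, MemLp u 2 π → MemLp (fun p : X × X => u p.2) 2 (π ⊗ₘ P) := by
    intro u hu
    have : MemLp u 2 ((π ⊗ₘ P).map Prod.snd) := by
      rw [← Measure.snd, Measure.snd_compProd, hrev.invariant.def]; exact hu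
    exact this.comp_of_map measurable_snd.aemeasurable
  have hint : ∀ {u v : X → ℝ}, MemLp u 2 π → MemLp v 2 π →
      ∫ p, u p.1 * v p.2 ∂(π ⊗ₘ P) = ∫ x, u x * kernelAct P v x ∂π := by
    intro u v hu hv
    refine (Measure.integral_compProd ((hfst hu).integrable_mul (hsnd hv))).trans ?_
    simp only [Pi.mul_apply]
    simp only [integral_const_mul]
    rfl
  calc ∫ x, f x * kernelAct P g x ∂π = ∫ p, f p.1 * g p.2 ∂(π ⊗ₘ P) := (hint hf hg).symm
    _ = ∫ p, f p.1 * g p.2 ∂((π ⊗ₘ P).map Prod.swap) := by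
        rw [map_swap_compProd_of_isReversible hrev]
    _ = ∫ p, f p.2 * g p.1 ∂(π ⊗ₘ P) :=
        integral_map_equiv (MeasurableEquiv.prodComm (α := X) (β := X)) _
    _ = ∫ x, g x * kernelAct P f x ∂π := by
        rw [← hint hg hf]
        exact integral_congr_ae (.of_forall fun p => mul_comm _ _)
    _ = ∫ x, kernelAct P f x * g x ∂π := integral_congr_ae (.of_forall fun x => mul_comm _ _)

lemma integral_mul_kernelAct_pow_comm (hrev : Kernel.IsReversible P π) {f g : X → ℝ}
    (hf : BddMeas f) (hg : BddMeas g) (k : ℕ) :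
    ∫ x, f x * kernelAct (P ^ k) g x ∂π = ∫ x, kernelAct (P ^ k) f x * g x ∂π := by
  induction k generalizing f g with
  | zero => rw [kernelAct_pow_zero _ hf.1, kernelAct_pow_zero _ hg.1]
  | succ k ih =>
    have h1 : kernelAct (P ^ (k + 1)) g = kernelAct (P ^ k) (kernelAct P g) :=
      funext fun x => kernelAct_pow_succ' P k (hg.integrable _)
    have h2 : kernelAct (P ^ (k + 1)) f = kernelAct P (kernelAct (P ^ k) f) :=
      funext fun x => kernelAct_pow_succ P k (hf.integrable _)
    rw [h1, h2, ih hf hg.kernelAct,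
      integral_mul_kernelAct_comm hrev (hf.kernelAct.memLp π) (hg.memLp π)]

lemma transitionOperator_toLp (h : Kernel.Invariant P π) {f : X → ℝ} (hf : BddMeas f) :
    transitionOperator P π h ((hf.memLp π).toLp f) =
      (hf.kernelAct.memLp π).toLp (kernelAct P f) := by
  ext1
  refine (transitionOperator_ae_eq P π h _).trans ((kernelAct_congr h ?_).trans
    (MemLp.coeFn_toLp (hf.kernelAct.memLp π)).symm)
  exact MemLp.coeFn_toLp (hf.memLp π)

lemma transitionOperator_pow_toLp (h : Kernel.Invariant P π) {f : X → ℝ} (hf : BddMeas f) (k : ℕ) :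
    (transitionOperator P π h ^ k) ((hf.memLp π).toLp f) =
      (hf.kernelAct.memLp π).toLp (kernelAct (P ^ k) f) := by
  induction k with
  | zero => simp only [kernelAct_pow_zero P hf.1]; rfl
  | succ k ih =>
    rw [pow_succ', mul_apply_eq_comp, ih, transitionOperator_toLp h hf.kernelAct]
    congr 1
    exact funext fun x => (kernelAct_pow_succ P k (hf.integrable _)).symm

lemma isSelfAdjoint_transitionOperator (hrev : Kernel.IsReversible P π) :
    IsSelfAdjoint (transitionOperator P π hrev.invariant) := by
  rw [ContinuousLinearMap.isSelfAdjoint_iff_isSymmetric]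
  intro f g
  have h := integral_mul_kernelAct_comm hrev (Lp.memLp f) (Lp.memLp g)
  change inner ℝ (transitionOperator P π _ f) g = inner ℝ f (transitionOperator P π _ g)
  rw [L2.inner_def, L2.inner_def]
  calc ∫ x, inner ℝ (transitionOperator P π hrev.invariant f x) (g x) ∂π
      = ∫ x, kernelAct P f x * g x ∂π := by
        refine integral_congr_ae ?_
        filter_upwards [transitionOperator_ae_eq P π hrev.invariant f] with x hx
        rw [hx]; exact mul_comm _ _
    _ = ∫ x, f x * kernelAct P g x ∂π := h.symm
    _ = _ := by
        refine integral_congr_ae ?_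
        filter_upwards [transitionOperator_ae_eq P π hrev.invariant g] with x hx
        rw [hx]; exact mul_comm _ _

/-- The spectral hypothesis enters the proof only here. -/
lemma integral_mul_kernelAct_pow_antitone (hrev : Kernel.IsReversible P π)
    (hspec : HasNonnegEigenvalues P π hrev) {f : X → ℝ} (hf : BddMeas f) :
    Antitone fun k : ℕ => ∫ x, f x * kernelAct (P ^ k) f x ∂π := by
  refine antitone_nat_of_succ_le fun k => ?_
  have h := inner_pow_succ_le (isSelfAdjoint_transitionOperator hrev) hspec
    (LinearMap.mkContinuous_norm_le _ zero_le_one _) ((hf.memLp π).toLp f) k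
  rw [transitionOperator_pow_toLp _ hf, transitionOperator_pow_toLp _ hf, inner_toLp,
    inner_toLp] at h
  exact h

lemma integral_mul_kernelAct_pow_two_mul (hrev : Kernel.IsReversible P π) {f : X → ℝ}
    (hf : BddMeas f) (k : ℕ) :
    ∫ x, f x * kernelAct (P ^ (2 * k)) f x ∂π = ∫ x, kernelAct (P ^ k) f x ^ 2 ∂π := by
  have h1 : kernelAct (P ^ (2 * k)) f = kernelAct (P ^ k) (kernelAct (P ^ k) f) := by
    funext x
    rw [two_mul, kernelAct_pow_add P k k (hf.integrable _)]
    rfl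
  rw [h1, integral_mul_kernelAct_pow_comm hrev hf hf.kernelAct]
  simp only [sq]

lemma integral_sub_sub_const {u v : X → ℝ} (hu : Integrable u π) (hv : Integrable v π) (c : ℝ) :
    ∫ x, (u x - (v x - c)) ∂π = ∫ x, u x ∂π - (∫ x, v x ∂π - c) := by
  have h1 : ∫ x, (v x - c) ∂π = ∫ x, v x ∂π - c := by
    rw [integral_sub hv (integrable_const _)]
    simp
  rw [← h1]
  exact integral_sub hu (hv.sub (integrable_const c))

/-- Comparison of total variation and `L²` distances, for the measure `g π` and `π`. -/
lemma abs_integral_mul_sub_le {g f : X → ℝ} (hg : BddMeas g) (hg1 : ∫ x, g x ∂π = 1)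
    (hf : Measurable f) (hf01 : ∀ x, f x ∈ Set.Icc (0 : ℝ) 1) :
    |∫ x, g x * f x ∂π - ∫ x, f x ∂π| ≤ 1 / 2 * Real.sqrt (∫ x, g x ^ 2 ∂π - 1) := by
  have hfb := BddMeas.of_mem_Icc hf hf01
  have hu := hg.sub (BddMeas.const 1)
  -- As `g - 1` has mean zero, `f` may be centred at `1/2`, where it is at most `1/2` in absolute
  -- value; hence the factor `1/2`.
  have e1 : ∫ x, g x * f x ∂π - ∫ x, f x ∂π = ∫ x, (g x - 1) * (f x - 1 / 2) ∂π := by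
    have : ∀ x, (g x - 1) * (f x - 1 / 2) = g x * f x - f x - (1 / 2 * g x - 1 / 2) :=
      fun x => by ring
    simp only [this]
    rw [integral_sub_sub_const (((hg.mul hfb).sub hfb).integrable π)
      ((hg.integrable π).const_mul _), integral_const_mul, hg1,
      integral_sub ((hg.mul hfb).integrable π) (hfb.integrable π)]
    ring
  have e2 : ∫ x, g x ^ 2 ∂π - 1 = ∫ x, (g x - 1) ^ 2 ∂π := by
    have : ∀ x, (g x - 1) ^ 2 = g x * g x - (2 * g x - 1) := fun x => by ring
    simp only [this]
    rw [integral_sub_sub_const ((hg.mul hg).integrable π) ((hg.integrable π).const_mul _),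
      integral_const_mul, hg1]
    simp only [← sq]
    ring
  have h1 : |∫ x, g x * f x ∂π - ∫ x, f x ∂π| ≤ 1 / 2 * ∫ x, |g x - 1| ∂π := by
    rw [e1, ← integral_const_mul]
    refine (abs_integral_le_integral_abs).trans (integral_mono
      ((hu.mul (hfb.sub (BddMeas.const _))).integrable π).abs
      ((hu.integrable π).abs.const_mul _) fun x => ?_)
    simp only [abs_mul]
    rw [mul_comm]
    have : |f x - 1 / 2| ≤ 1 / 2 := by
      have := hf01 x
      rw [Set.mem_Icc] at this
      rw [abs_le]; constructor <;> linarith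
    gcongr
  have h2 : (∫ x, |g x - 1| ∂π) ^ 2 ≤ ∫ x, (g x - 1) ^ 2 ∂π := by
    set I := ∫ x, |g x - 1| ∂π
    have h3 : 0 ≤ ∫ x, (|g x - 1| - I) ^ 2 ∂π := integral_nonneg fun x => sq_nonneg _
    have : ∀ x, (|g x - 1| - I) ^ 2 = (g x - 1) * (g x - 1) - (2 * I * |g x - 1| - I ^ 2) :=
      fun x => by rw [sub_sq, sq_abs]; ring
    simp only [this] at h3
    rw [integral_sub_sub_const ((hu.mul hu).integrable π) ((hu.integrable π).abs.const_mul _),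
      integral_const_mul] at h3
    simp only [← sq] at h3
    change 0 ≤ _ - (2 * I * I - I ^ 2) at h3
    linarith
  refine h1.trans ?_
  gcongr
  rw [e2]
  exact Real.le_sqrt_of_sq_le h2

end Reversible

/-! ### The first regeneration time. -/

section Tail

open Finset

open Classical in
/-- Tail probabilities `t ↦ P_x(T > t)` of the first regeneration time `T` of the split chain:
outside `C` the chain takes one step of `P`; at a point of `C` it takes `m` steps at once, and
regenerates at the end of them with probability `ε`. -/
noncomputable def tail {X : Type*} [MeasurableSpace X] (P : Kernel X X) (C : Set X) (ν : Measure X)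
    (m : ℕ) (ε : ℝ) : ℕ → X → ℝ
  | 0 => fun _ => 1
  | t + 1 => fun x =>
    if x ∈ C then
      if t + 1 < m then 1
      -- In this branch `t - (m - 1)` is the remaining time `t + 1 - m`, written so that it is below
      -- `t + 1` for every `m`.
      else ∫ y, tail P C ν m ε (t - (m - 1)) y ∂((P ^ m) x) -
        ε * ∫ y, tail P C ν m ε (t - (m - 1)) y ∂ν
    else ∫ y, tail P C ν m ε t y ∂(P x)

variable {X : Type*} [MeasurableSpace X] {P : Kernel X X} {C : Set X} {ν : Measure X} {m : ℕ}
  {ε : ℝ}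

lemma tail_zero (x : X) : tail P C ν m ε 0 x = 1 := by rw [tail]

lemma tail_succ_of_notMem {x : X} (hx : x ∉ C) (t : ℕ) :
    tail P C ν m ε (t + 1) x = ∫ y, tail P C ν m ε t y ∂(P x) := by
  rw [tail]
  exact if_neg hx

lemma tail_of_mem_of_lt {x : X} (hx : x ∈ C) {t : ℕ} (ht : t < m) :
    tail P C ν m ε t x = 1 := by
  cases t with
  | zero => exact tail_zero x
  | succ t => rw [tail]; exact (if_pos hx).trans (if_pos ht)

lemma tail_add_of_mem {x : X} (hx : x ∈ C) (hm : 1 ≤ m) (t : ℕ) :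
    tail P C ν m ε (t + m) x =
      ∫ y, tail P C ν m ε t y ∂((P ^ m) x) - ε * ∫ y, tail P C ν m ε t y ∂ν := by
  obtain ⟨k, rfl⟩ : ∃ k, m = k + 1 := ⟨m - 1, by omega⟩
  rw [← add_assoc, tail]
  refine (if_pos hx).trans ((if_neg (by omega)).trans ?_)
  rw [show t + k - (k + 1 - 1) = t by omega]

/-- The residual measure of the minorization. -/
lemma IsSmallSet.exists_residual [IsMarkovKernel P] (hs : IsSmallSet P C ν m ε) {x : X}
    (hx : x ∈ C) : ∃ R : Measure X, IsFiniteMeasure R ∧ ∀ f : X → ℝ, Integrable f ((P ^ m) x) →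
      Integrable f ν ∧ Integrable f R ∧
        ∫ y, f y ∂((P ^ m) x) = ε * ∫ y, f y ∂ν + ∫ y, f y ∂(R) := by
  have := hs.isProbabilityMeasure
  have hle : ENNReal.ofReal ε • ν ≤ (P ^ m) x := Measure.le_iff.2 fun S hS => by
    simpa using hs.minorization x hx S hS
  have hfin : IsFiniteMeasure (ENNReal.ofReal ε • ν) :=
    isFiniteMeasure_of_le ((P ^ m) x) hle
  have hadd := Measure.sub_add_cancel_of_le hle
  refine ⟨(P ^ m) x - ENNReal.ofReal ε • ν, inferInstance, fun f hf => ?_⟩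
  have h1 : Integrable f (ENNReal.ofReal ε • ν) := hf.mono_measure hle
  have h2 : Integrable f ((P ^ m) x - ENNReal.ofReal ε • ν) := hf.mono_measure Measure.sub_le
  refine ⟨?_, h2, ?_⟩
  · exact (integrable_smul_measure (by simpa using hs.eps_pos) ENNReal.ofReal_ne_top).1 h1
  · conv_lhs => rw [← hadd]
    rw [integral_add_measure h2 h1, integral_smul_measure, ENNReal.toReal_ofReal hs.eps_pos.le,
      smul_eq_mul, add_comm]

lemma IsSmallSet.eps_le_one [IsMarkovKernel P] (hs : IsSmallSet P C ν m ε) {x : X}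
    (hx : x ∈ C) : ε ≤ 1 := by
  have := hs.isProbabilityMeasure
  simpa using hs.minorization x hx Set.univ .univ

variable [IsMarkovKernel P]

/-- Measurability and bounds are proved together because each integral in the recursion needs both
at earlier times. On `C` the difference of integrals is one integral against the residual measure,
which is positive of mass `1 - ε`. -/
lemma bddMeas_tail_and_mem_Icc (hs : IsSmallSet P C ν m ε) (t : ℕ) :
    BddMeas (tail P C ν m ε t) ∧ ∀ x, tail P C ν m ε t x ∈ Set.Icc 0 1 := by
  have := hs.isProbabilityMeasure
  induction t using Nat.strong_induction_on with
  | _ t ih =>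
  have hm : Measurable (tail P C ν m ε t) := by
    cases t with
    | zero => rw [tail]; exact measurable_const
    | succ t =>
      have h1 := (ih t (by omega)).1
      have h2 := (ih (t - (m - 1)) (by omega)).1
      rw [tail]
      refine Measurable.ite hs.measurableSet (.ite (.const _) measurable_const ?_) h1.kernelAct.1
      exact (BddMeas.kernelAct (P := P ^ m) h2).1.sub_const _
  have hI : ∀ x, tail P C ν m ε t x ∈ Set.Icc 0 1 := by
    intro x
    by_cases hx : x ∈ C
    · by_cases ht : t < m
      · rw [tail_of_mem_of_lt hx ht]; simp
      · obtain ⟨s, rfl⟩ : ∃ s, t = s + m := ⟨t - m, by omega⟩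
        have hm1 := hs.one_le_m
        obtain ⟨hb, h01⟩ := ih s (by omega)
        obtain ⟨R, hR, hRi⟩ := hs.exists_residual hx
        have h1 := (hRi _ (hb.integrable _)).2.2
        have h2 := (hRi (fun _ => 1) (integrable_const _)).2.2
        simp only [integral_const, smul_eq_mul, mul_one, probReal_univ] at h2
        rw [tail_add_of_mem hx hm1, h1, add_sub_cancel_left]
        refine ⟨integral_nonneg fun y => (h01 y).1, ?_⟩
        have h3 : ∫ y, tail P C ν m ε s y ∂(R) ≤ ∫ _, 1 ∂(R) :=
          integral_mono (hb.integrable _) (integrable_const _) fun y => (h01 y).2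
        rw [integral_const, smul_eq_mul, mul_one] at h3
        linarith [hs.eps_pos]
    · cases t with
      | zero => rw [tail_zero]; simp
      | succ t =>
        obtain ⟨hb, h01⟩ := ih t (by omega)
        rw [tail_succ_of_notMem hx]
        refine ⟨integral_nonneg fun y => (h01 y).1, ?_⟩
        have h3 : ∫ y, tail P C ν m ε t y ∂(P x) ≤ ∫ _, 1 ∂(P x) :=
          integral_mono (hb.integrable _) (integrable_const _) fun y => (h01 y).2
        simpa using h3
  exact ⟨.of_mem_Icc hm hI, hI⟩

lemma bddMeas_tail (hs : IsSmallSet P C ν m ε) (t : ℕ) : BddMeas (tail P C ν m ε t) :=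
  (bddMeas_tail_and_mem_Icc hs t).1

lemma tail_nonneg (hs : IsSmallSet P C ν m ε) (t : ℕ) (x : X) : 0 ≤ tail P C ν m ε t x :=
  ((bddMeas_tail_and_mem_Icc hs t).2 x).1

lemma tail_le_one (hs : IsSmallSet P C ν m ε) (t : ℕ) (x : X) : tail P C ν m ε t x ≤ 1 :=
  ((bddMeas_tail_and_mem_Icc hs t).2 x).2

lemma tail_succ_le (hs : IsSmallSet P C ν m ε) (t : ℕ) (x : X) :
    tail P C ν m ε (t + 1) x ≤ tail P C ν m ε t x := by
  induction t using Nat.strong_induction_on generalizing x with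
  | _ t ih =>
  have hm1 := hs.one_le_m
  by_cases hx : x ∈ C
  · by_cases ht : t < m
    · rw [tail_of_mem_of_lt hx ht]
      exact tail_le_one hs _ _
    · obtain ⟨s, rfl⟩ : ∃ s, t = s + m := ⟨t - m, by omega⟩
      obtain ⟨R, hR, hRi⟩ := hs.exists_residual hx
      have h1 := (hRi _ ((bddMeas_tail hs s).integrable _)).2.2
      have h2 := (hRi _ ((bddMeas_tail hs (s + 1)).integrable _)).2.2
      rw [add_right_comm, tail_add_of_mem hx hm1, tail_add_of_mem hx hm1, h1, h2,
        add_sub_cancel_left, add_sub_cancel_left]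
      exact integral_mono ((bddMeas_tail hs _).integrable _) ((bddMeas_tail hs _).integrable _)
        (ih s (by omega))
  · cases t with
    | zero => rw [tail_zero]; exact tail_le_one hs _ _
    | succ t =>
      rw [tail_succ_of_notMem hx, tail_succ_of_notMem hx]
      exact integral_mono ((bddMeas_tail hs _).integrable _) ((bddMeas_tail hs _).integrable _)
        (ih t (by omega))

/-- Decomposition of the law at time `t` according to the first regeneration time. -/
lemma sum_tail_sub_mul_le (hs : IsSmallSet P C ν m ε) {f : X → ℝ} (hf : BddMeas f)
    (hf0 : ∀ x, 0 ≤ f x) (t : ℕ) (x : X) :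
    ∑ s ∈ range t, (tail P C ν m ε s x - tail P C ν m ε (s + 1) x) *
      ∫ y, kernelAct (P ^ (t - 1 - s)) f y ∂ν ≤ kernelAct (P ^ t) f x := by
  have := hs.isProbabilityMeasure
  have hm1 := hs.one_le_m
  have hint : ∀ (μ : Measure X) [IsFiniteMeasure μ] (s : ℕ) (c : ℝ), Integrable (fun y =>
      (tail P C ν m ε s y - tail P C ν m ε (s + 1) y) * c) μ := fun μ _ s c =>
    ((((bddMeas_tail hs s).sub (bddMeas_tail hs (s + 1))).mul (.const c)).integrable μ)
  have heval : ∀ (μ : Measure X) [IsFiniteMeasure μ] (s : ℕ) (c : ℝ), ∫ y,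
      (tail P C ν m ε s y - tail P C ν m ε (s + 1) y) * c ∂μ =
        (∫ y, tail P C ν m ε s y ∂μ - ∫ y, tail P C ν m ε (s + 1) y ∂μ) * c := fun μ _ s c => by
    rw [integral_mul_const, integral_sub ((bddMeas_tail hs s).integrable μ)
      ((bddMeas_tail hs (s + 1)).integrable μ)]
  induction t using Nat.strong_induction_on generalizing x with
  | _ t ih =>
  by_cases hx : x ∈ C
  · by_cases ht : t < m
    · rw [sum_eq_zero]
      · exact integral_nonneg hf0
      · intro s hst
        have := mem_range.1 hst
        rw [tail_of_mem_of_lt hx (by omega), tail_of_mem_of_lt hx (by omega), sub_self, zero_mul]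
    · obtain ⟨u, rfl⟩ : ∃ u, t = m + u := ⟨t - m, by omega⟩
      obtain ⟨R, hR, hRi⟩ := hs.exists_residual hx
      have h1 := fun s => (hRi _ ((bddMeas_tail hs s).integrable _)).2.2
      have htail : ∀ s, tail P C ν m ε (m + s) x = ∫ y, tail P C ν m ε s y ∂(R) := fun s => by
        rw [add_comm, tail_add_of_mem hx hm1, h1, add_sub_cancel_left]
      have htail0 : tail P C ν m ε m x = 1 - ε := by
        have h := tail_add_of_mem (P := P) (ν := ν) (ε := ε) hx hm1 0
        simpa [tail_zero] using h
      have hlast : tail P C ν m ε (m - 1) x = 1 := tail_of_mem_of_lt hx (by omega)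
      -- From `C` no regeneration occurs before time `m`, and one occurs at time `m` with
      -- probability `ε`; only `s = m - 1` contributes.
      have hfst : ∑ s ∈ range m, (tail P C ν m ε s x - tail P C ν m ε (s + 1) x) *
          ∫ y, kernelAct (P ^ (m + u - 1 - s)) f y ∂ν = ε * ∫ y, kernelAct (P ^ u) f y ∂ν := by
        rw [sum_eq_single_of_mem (m - 1) (mem_range.2 (by omega))]
        · rw [hlast, show m - 1 + 1 = m by omega, htail0,
            show m + u - 1 - (m - 1) = u by omega]
          ring
        · intro s hst hne
          have := mem_range.1 hst
          rw [tail_of_mem_of_lt hx (by omega), tail_of_mem_of_lt hx (by omega), sub_self, zero_mul]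
      have hsnd : ∑ s ∈ range u, (tail P C ν m ε (m + s) x - tail P C ν m ε (m + s + 1) x) *
          ∫ y, kernelAct (P ^ (m + u - 1 - (m + s))) f y ∂ν ≤
            ∫ y, kernelAct (P ^ u) f y ∂(R) := by
        calc _ = ∫ y, ∑ s ∈ range u, (tail P C ν m ε s y - tail P C ν m ε (s + 1) y) *
                ∫ y, kernelAct (P ^ (u - 1 - s)) f y ∂ν ∂(R) := by
              rw [integral_finsetSum _ fun s _ => hint R s _]
              refine sum_congr rfl fun s _ => ?_
              rw [heval, add_assoc, htail, htail,
                show m + u - 1 - (m + s) = u - 1 - s by omega]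
          _ ≤ _ := integral_mono (integrable_finsetSum _ fun s _ => hint R s _)
                (hf.kernelAct.integrable _) (ih u (by omega))
      rw [sum_range_add, hfst, kernelAct_pow_add P m u (hf.integrable _),
        (hRi _ (hf.kernelAct.integrable _)).2.2]
      linarith
  · cases t with
    | zero => exact integral_nonneg hf0
    | succ u =>
      -- A first step from outside `C` cannot regenerate, so the term `s = 0` vanishes.
      have h1 : tail P C ν m ε 1 x = 1 := by
        rw [tail_succ_of_notMem hx]; simp [tail_zero]
      have hz : (tail P C ν m ε 0 x - tail P C ν m ε (0 + 1) x) *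
          ∫ y, kernelAct (P ^ (u + 1 - 1 - 0)) f y ∂ν = 0 := by
        rw [zero_add, h1, tail_zero, sub_self, zero_mul]
      rw [sum_range_succ', hz, add_zero, kernelAct_pow_succ P u (hf.integrable _)]
      calc _ = ∫ y, ∑ s ∈ range u, (tail P C ν m ε s y - tail P C ν m ε (s + 1) y) *
              ∫ y, kernelAct (P ^ (u - 1 - s)) f y ∂ν ∂(P x) := by
            rw [integral_finsetSum _ fun s _ => hint (P x) s _]
            refine sum_congr rfl fun s _ => ?_
            rw [heval, tail_succ_of_notMem hx, tail_succ_of_notMem hx,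
              show u + 1 - 1 - (s + 1) = u - 1 - s by omega]
        _ ≤ _ := integral_mono (integrable_finsetSum _ fun s _ => hint (P x) s _)
              (hf.kernelAct.integrable _) (ih u (by omega))

/-- Geometric tails of the regeneration time from a geometric supermartingale. -/
lemma tail_le_zpow_mul (hs : IsSmallSet P C ν m ε) {U : X → ℝ} {rho : ℝ} (hrho : 0 < rho)
    (hrho1 : rho ≤ 1) (hU1 : ∀ x, 1 ≤ U x) (hUi : ∀ t x, Integrable U ((P ^ t) x))
    (hdrift : ∀ x, x ∉ C → ∫ y, U y ∂(P x) ≤ rho * U x)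
    (hres : ∀ x, x ∈ C → ∫ y, U y ∂((P ^ m) x) - ε * ∫ y, U y ∂ν ≤ rho ^ m) (t : ℕ) (x : X) :
    tail P C ν m ε t x ≤ rho ^ ((t : ℤ) + 1 - m) * U x := by
  have hm1 := hs.one_le_m
  have hle : ∀ k : ℤ, k ≤ 0 → ∀ x, 1 ≤ rho ^ k * U x := fun k hk x => by
    have : 1 ≤ rho ^ k := one_le_zpow_of_nonpos₀ hrho hrho1 hk
    nlinarith [hU1 x]
  induction t using Nat.strong_induction_on generalizing x with
  | _ t ih =>
  by_cases hx : x ∈ C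
  · by_cases ht : t < m
    -- The tail equals `1` up to time `m - 1`, which is why the exponent is `t + 1 - m`.
    · rw [tail_of_mem_of_lt hx ht]
      exact hle _ (by omega) x
    · obtain ⟨u, rfl⟩ : ∃ u, t = u + m := ⟨t - m, by omega⟩
      obtain ⟨R, hR, hRi⟩ := hs.exists_residual hx
      obtain ⟨-, hUR, hUe⟩ := hRi U (hUi m x)
      rw [tail_add_of_mem hx hm1, (hRi _ ((bddMeas_tail hs u).integrable _)).2.2,
        add_sub_cancel_left]
      have h1 : ∫ y, U y ∂(R) ≤ rho ^ m := by linarith [hres x hx]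
      have h2 : 0 ≤ rho ^ ((u : ℤ) + 1 - m) := by positivity
      calc ∫ y, tail P C ν m ε u y ∂(R) ≤ ∫ y, rho ^ ((u : ℤ) + 1 - m) * U y ∂(R) :=
            integral_mono ((bddMeas_tail hs u).integrable _) (hUR.const_mul _) (ih u (by omega))
        _ = rho ^ ((u : ℤ) + 1 - m) * ∫ y, U y ∂(R) := integral_const_mul _ _
        _ ≤ rho ^ ((u : ℤ) + 1 - m) * rho ^ m := by gcongr
        _ = rho ^ (((u + m : ℕ) : ℤ) + 1 - m) * 1 := by
            rw [← zpow_natCast, ← zpow_add₀ hrho.ne', mul_one]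
            congr 1
            push_cast; ring
        _ ≤ _ := by gcongr; exact hU1 x
  · cases t with
    | zero =>
      rw [tail_zero]
      exact hle _ (by omega) x
    | succ u =>
      have hUP : Integrable U (P x) := by simpa using hUi 1 x
      rw [tail_succ_of_notMem hx]
      calc ∫ y, tail P C ν m ε u y ∂(P x) ≤ ∫ y, rho ^ ((u : ℤ) + 1 - m) * U y ∂(P x) :=
            integral_mono ((bddMeas_tail hs u).integrable _) (hUP.const_mul _) (ih u (by omega))
        _ = rho ^ ((u : ℤ) + 1 - m) * ∫ y, U y ∂(P x) := integral_const_mul _ _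
        _ ≤ rho ^ ((u : ℤ) + 1 - m) * (rho * U x) := by gcongr; exact hdrift x hx
        _ = rho ^ (((u + 1 : ℕ) : ℤ) + 1 - m) * U x := by
            rw [← mul_assoc, ← zpow_add_one₀ hrho.ne']
            congr 2
            push_cast; ring

end Tail

/-! ### Consequences of the drift condition. -/

section Drift

open Filter Topology

variable {X : Type*} [MeasurableSpace X] {P : Kernel X X} {C : Set X} {V : X → ℝ} {lam K : ℝ}

lemma integrable_of_lintegral_ofReal_le {μ : Measure X} {f : X → ℝ} (hf : Measurable f)
    (hf0 : ∀ x, 0 ≤ f x) {a : ℝ} (h : ∫⁻ x, ENNReal.ofReal (f x) ∂μ ≤ ENNReal.ofReal a) :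
    Integrable f μ := by
  refine ⟨hf.aestronglyMeasurable, ?_⟩
  rw [hasFiniteIntegral_iff_ofReal (.of_forall hf0)]
  exact h.trans_lt ENNReal.ofReal_lt_top

lemma integral_le_of_lintegral_ofReal_le {μ : Measure X} {f : X → ℝ} (hf : Measurable f)
    (hf0 : ∀ x, 0 ≤ f x) {a : ℝ} (ha : 0 ≤ a)
    (h : ∫⁻ x, ENNReal.ofReal (f x) ∂μ ≤ ENNReal.ofReal a) : ∫ x, f x ∂μ ≤ a := by
  rw [integral_eq_lintegral_of_nonneg_ae (.of_forall hf0) hf.aestronglyMeasurable]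
  exact ENNReal.toReal_le_of_le_ofReal ha h

/-- Iterating in extended nonnegative integrals makes integrability of `V` a conclusion. It serves
with `c = 0` to show `C` nonempty, and with `c = K - lam` in general. -/
lemma lintegral_pow_le_of_drift [IsMarkovKernel P] (hV : Measurable V) (hV1 : ∀ x, 1 ≤ V x)
    (hlam : 0 < lam) (hlam1 : lam < 1) {c : ℝ} (hc : 0 ≤ c)
    (h : ∀ x, ∫⁻ y, ENNReal.ofReal (V y) ∂(P x) ≤ ENNReal.ofReal (lam * V x + c)) (t : ℕ) (x : X) :
    ∫⁻ y, ENNReal.ofReal (V y) ∂((P ^ t) x) ≤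
      ENNReal.ofReal (lam ^ t * V x + c * (1 - lam ^ t) / (1 - lam)) := by
  induction t generalizing x with
  | zero =>
    rw [pow_zero]
    change ∫⁻ y, ENNReal.ofReal (V y) ∂(Kernel.id x) ≤ _
    rw [Kernel.id_apply, lintegral_dirac' _ hV.ennreal_ofReal]
    simp
  | succ t ih =>
    have hV0 : ∀ x, 0 ≤ V x := fun x => zero_le_one.trans (hV1 x)
    have hct : 0 ≤ c * (1 - lam ^ t) / (1 - lam) :=
      div_nonneg (mul_nonneg hc (sub_nonneg.2 (pow_le_one₀ hlam.le hlam1.le)))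
        (sub_nonneg.2 hlam1.le)
    rw [lintegral_pow_succ P t hV.ennreal_ofReal]
    calc ∫⁻ y, ∫⁻ z, ENNReal.ofReal (V z) ∂((P ^ t) y) ∂(P x)
        ≤ ∫⁻ y, ENNReal.ofReal (lam ^ t) * ENNReal.ofReal (V y) +
            ENNReal.ofReal (c * (1 - lam ^ t) / (1 - lam)) ∂(P x) := by
          refine lintegral_mono fun y => (ih y).trans ?_
          rw [ENNReal.ofReal_add (by have := hV0 y; positivity) hct,
            ENNReal.ofReal_mul (by positivity)]
      _ = ENNReal.ofReal (lam ^ t) * ∫⁻ y, ENNReal.ofReal (V y) ∂(P x) +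
            ENNReal.ofReal (c * (1 - lam ^ t) / (1 - lam)) := by
          rw [lintegral_add_right _ measurable_const,
            lintegral_const_mul _ hV.ennreal_ofReal]
          simp
      _ ≤ ENNReal.ofReal (lam ^ t) * ENNReal.ofReal (lam * V x + c) +
            ENNReal.ofReal (c * (1 - lam ^ t) / (1 - lam)) := by gcongr; exact h x
      _ = _ := by
          rw [← ENNReal.ofReal_mul (by positivity), ← ENNReal.ofReal_add
            (by have := hV0 x; positivity) hct]
          congr 1
          have : 1 - lam ≠ 0 := by linarith
          field_simp
          ring

namespace IsDriftFunction

lemma nonneg (hd : IsDriftFunction P C V lam K) (x : X) : 0 ≤ V x :=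
  zero_le_one.trans (hd.one_le x)

lemma integral_le_of_notMem (hd : IsDriftFunction P C V lam K) (hlam : 0 < lam)
    {x : X} (hx : x ∉ C) : ∫ y, V y ∂(P x) ≤ lam * V x :=
  integral_le_of_lintegral_ofReal_le hd.measurable hd.nonneg
    (mul_nonneg hlam.le (hd.nonneg x)) (hd.drift x hx)

variable [IsMarkovKernel P] (hd : IsDriftFunction P C V lam K) (hlam : 0 < lam)
include hd

lemma one_le_bound {x : X} (hx : x ∈ C) : 1 ≤ K := by
  have h1 : (1 : ℝ≥0∞) ≤ ENNReal.ofReal K := by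
    refine le_trans ?_ (hd.bound x hx)
    calc (1 : ℝ≥0∞) = ∫⁻ _, 1 ∂(P x) := by simp
      _ ≤ _ := lintegral_mono fun y => by simpa using hd.one_le y
  simpa using h1

lemma integral_le_of_mem {x : X} (hx : x ∈ C) : ∫ y, V y ∂(P x) ≤ K :=
  integral_le_of_lintegral_ofReal_le hd.measurable hd.nonneg
    (zero_le_one.trans (hd.one_le_bound hx)) (hd.bound x hx)

include hlam

/-- With `C` empty the drift would hold everywhere, giving `1 ≤ P^t V ≤ lam^t V → 0`. -/
lemma nonempty_set [hX : Nonempty X] : C.Nonempty := by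
  by_contra hC
  rw [Set.not_nonempty_iff_eq_empty] at hC
  obtain ⟨x⟩ := hX
  have h1 := lintegral_pow_le_of_drift (P := P) (c := 0) hd.measurable hd.one_le hlam
    hd.lam_lt_one le_rfl
    (fun x => by rw [add_zero]; exact hd.drift x (by simp [hC]))
  have h2 : ∀ t : ℕ, 1 ≤ lam ^ t * V x := fun t => by
    have : (1 : ℝ≥0∞) ≤ ENNReal.ofReal (lam ^ t * V x + 0 * (1 - lam ^ t) / (1 - lam)) := by
      refine le_trans ?_ (h1 t x)
      calc (1 : ℝ≥0∞) = ∫⁻ _, 1 ∂((P ^ t) x) := by simp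
        _ ≤ _ := lintegral_mono fun y => by simpa using hd.one_le y
    simpa using this
  have h3 : Tendsto (fun t : ℕ => lam ^ t * V x) atTop (𝓝 (0 * V x)) :=
    (tendsto_pow_atTop_nhds_zero_of_lt_one hlam.le hd.lam_lt_one).mul_const _
  have := ge_of_tendsto' h3 h2
  rw [zero_mul] at this
  linarith

lemma one_le_K [Nonempty X] : 1 ≤ K := by
  obtain ⟨x, hx⟩ := hd.nonempty_set hlam
  exact hd.one_le_bound hx

/-- One inequality covers both cases: on `C` because `V ≥ 1`, off `C` because `K ≥ 1 > lam`. -/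
lemma lintegral_le [Nonempty X] (x : X) :
    ∫⁻ y, ENNReal.ofReal (V y) ∂(P x) ≤ ENNReal.ofReal (lam * V x + (K - lam)) := by
  have hK := hd.one_le_K hlam
  have h1 := hd.lam_lt_one
  by_cases hx : x ∈ C
  · refine (hd.bound x hx).trans (ENNReal.ofReal_le_ofReal ?_)
    nlinarith [hd.one_le x]
  · refine (hd.drift x hx).trans (ENNReal.ofReal_le_ofReal ?_)
    linarith

lemma lintegral_pow_le [Nonempty X] (t : ℕ) (x : X) :
    ∫⁻ y, ENNReal.ofReal (V y) ∂((P ^ t) x) ≤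
      ENNReal.ofReal (lam ^ t * V x + (K - lam) * (1 - lam ^ t) / (1 - lam)) :=
  lintegral_pow_le_of_drift hd.measurable hd.one_le hlam hd.lam_lt_one
    (by linarith [hd.one_le_K hlam, hd.lam_lt_one]) (hd.lintegral_le hlam) t x

lemma integrable_pow [Nonempty X] (t : ℕ) (x : X) : Integrable V ((P ^ t) x) :=
  integrable_of_lintegral_ofReal_le hd.measurable hd.nonneg (hd.lintegral_pow_le hlam t x)

lemma integrable_kernel [Nonempty X] (x : X) : Integrable V (P x) := by
  simpa using hd.integrable_pow hlam 1 x

lemma integral_le_add [Nonempty X] (x : X) : ∫ y, V y ∂(P x) ≤ lam * V x + (K - lam) :=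
  integral_le_of_lintegral_ofReal_le hd.measurable hd.nonneg
    (by linarith [mul_nonneg hlam.le (hd.nonneg x), hd.one_le_K hlam, hd.lam_lt_one])
    (hd.lintegral_le hlam x)

lemma kernelAct_pow_le [Nonempty X] (t : ℕ) (x : X) : kernelAct (P ^ t) V x ≤
    lam ^ t * V x + (K - lam) * (1 - lam ^ t) / (1 - lam) := by
  refine integral_le_of_lintegral_ofReal_le hd.measurable hd.nonneg ?_
    (hd.lintegral_pow_le hlam t x)
  have h1 := hd.nonneg x
  have h2 := hd.lam_lt_one
  have h3 : 0 ≤ K - lam := by linarith [hd.one_le_K hlam]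
  have h4 : 0 ≤ 1 - lam ^ t := sub_nonneg.2 (pow_le_one₀ hlam.le h2.le)
  have h5 : 0 < 1 - lam := by linarith
  positivity

/-- The origin of `B`: the first step from `C` costs `K`, and the other `m - 1` follow the iterated
drift inequality. -/
lemma integral_pow_le_B [Nonempty X] {m : ℕ} (hm : 1 ≤ m) {x : X} (hx : x ∈ C) :
    ∫ y, V y ∂((P ^ m) x) ≤ B lam K m := by
  obtain ⟨k, rfl⟩ : ∃ k, m = k + 1 := ⟨m - 1, by omega⟩
  have hi := hd.integrable_kernel hlam x
  have h5 : 1 - lam ≠ 0 := by linarith [hd.lam_lt_one]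
  change kernelAct (P ^ (k + 1)) V x ≤ _
  rw [kernelAct_pow_succ P k (hd.integrable_pow hlam _ _)]
  calc ∫ y, kernelAct (P ^ k) V y ∂(P x)
      ≤ ∫ y, (lam ^ k * V y + (K - lam) * (1 - lam ^ k) / (1 - lam)) ∂(P x) :=
        integral_mono_of_nonneg (.of_forall fun y => integral_nonneg hd.nonneg)
          ((hi.const_mul _).add (integrable_const _))
          (.of_forall fun y => hd.kernelAct_pow_le hlam k y)
    _ = lam ^ k * ∫ y, V y ∂(P x) + (K - lam) * (1 - lam ^ k) / (1 - lam) := by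
        rw [integral_add (hi.const_mul _) (integrable_const _), integral_const_mul]
        simp
    _ ≤ lam ^ k * K + (K - lam) * (1 - lam ^ k) / (1 - lam) := by
        gcongr
        exact hd.integral_le_of_mem hx
    _ = B lam K (k + 1) := by
        rw [B]
        field_simp
        ring

variable {π : Measure X} [IsProbabilityMeasure π] (hinv : Kernel.Invariant P π)
include hinv

/-- Truncation allows invariance to be used before `V` is known to be integrable: replace `V` by
`P^t V ≤ lam^t V + c` under the cut-off, then let `t → ∞` by dominated convergence. -/
lemma integral_min_le (N : ℕ) : ∫ x, min (V x) N ∂π ≤ (K - lam) / (1 - lam) := by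
  have hX : Nonempty X := nonempty_of_isProbabilityMeasure π
  have h1 : 0 < 1 - lam := by linarith [hd.lam_lt_one]
  have h3 : 0 ≤ K - lam := by linarith [hd.one_le_K hlam]
  set c := (K - lam) / (1 - lam)
  have hc : 0 ≤ c := by positivity
  have hb : BddMeas fun x => min (V x) N := BddMeas.of_mem_Icc (a := 0) (b := N)
    (hd.measurable.min measurable_const)
    fun x => ⟨le_min (hd.nonneg x) N.cast_nonneg, min_le_right _ _⟩
  have hbt : ∀ t : ℕ, BddMeas fun x => min (lam ^ t * V x + c) N := fun t =>
    BddMeas.of_mem_Icc (a := 0) (b := N)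
      (((hd.measurable.const_mul _).add_const _).min measurable_const)
      fun x => ⟨le_min (by have := hd.nonneg x; positivity) N.cast_nonneg, min_le_right _ _⟩
  have hle : ∀ t : ℕ, ∫ x, min (V x) N ∂π ≤ ∫ x, min (lam ^ t * V x + c) N ∂π := by
    intro t
    rw [← integral_kernelAct (invariant_pow hinv t) (hb.integrable π)]
    refine integral_mono (hb.kernelAct.integrable π) ((hbt t).integrable π) fun x => le_min ?_ ?_
    · refine (integral_mono (hb.integrable _) (hd.integrable_pow hlam t x)
        fun y => min_le_left _ _).trans ((hd.kernelAct_pow_le hlam t x).trans ?_)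
      gcongr
      rw [mul_div_assoc, mul_comm (K - lam), div_mul_eq_mul_div]
      refine div_le_div_of_nonneg_right ?_ h1.le
      have : 0 ≤ lam ^ t := by positivity
      nlinarith
    · refine (integral_mono (hb.integrable _) (integrable_const (N : ℝ))
        fun y => min_le_right _ _).trans ?_
      simp
  have hlim : Tendsto (fun t : ℕ => ∫ x, min (lam ^ t * V x + c) N ∂π) atTop
      (𝓝 (∫ _, min c N ∂π)) := by
    refine tendsto_integral_of_dominated_convergence (fun _ => N)
      (fun t => (hbt t).1.aestronglyMeasurable) (integrable_const _)
      (fun t => .of_forall fun x => ?_) (.of_forall fun x => ?_)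
    · rw [Real.norm_of_nonneg (le_min (by have := hd.nonneg x; positivity) N.cast_nonneg)]
      exact min_le_right _ _
    · have h := (tendsto_pow_atTop_nhds_zero_of_lt_one hlam.le hd.lam_lt_one).mul_const (V x)
      have h' := (h.add_const c).min (tendsto_const_nhds (x := (N : ℝ)))
      simpa using h'
  have h := ge_of_tendsto' hlim hle
  simp only [integral_const, probReal_univ, smul_eq_mul, one_mul] at h
  exact h.trans (min_le_left _ _)

lemma lintegral_invariant_le :
    ∫⁻ x, ENNReal.ofReal (V x) ∂π ≤ ENNReal.ofReal ((K - lam) / (1 - lam)) := by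
  have hmeas : ∀ N : ℕ, Measurable fun x => min (V x) N := fun N =>
    hd.measurable.min measurable_const
  have hlim := lintegral_tendsto_of_tendsto_of_monotone (μ := π)
    (f := fun (N : ℕ) x => ENNReal.ofReal (min (V x) N)) (F := fun x => ENNReal.ofReal (V x))
    (fun N => (hmeas N).ennreal_ofReal.aemeasurable)
    (.of_forall fun x a b hab => ENNReal.ofReal_le_ofReal (by gcongr))
    (.of_forall fun x => by
      refine tendsto_const_nhds.congr' ?_
      obtain ⟨N, hN⟩ := exists_nat_ge (V x)
      filter_upwards [eventually_ge_atTop N] with n hn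
      rw [min_eq_left (hN.trans (by exact_mod_cast hn))])
  refine le_of_tendsto' hlim fun N => ?_
  have h0 : ∀ x, 0 ≤ min (V x) N := fun x => le_min (hd.nonneg x) N.cast_nonneg
  rw [← ofReal_integral_eq_lintegral_ofReal ((BddMeas.of_mem_Icc (a := 0) (b := N) (hmeas N)
    fun x => ⟨h0 x, min_le_right _ _⟩).integrable π) (.of_forall h0)]
  exact ENNReal.ofReal_le_ofReal (hd.integral_min_le hlam hinv N)

lemma integrable_invariant : Integrable V π :=
  integrable_of_lintegral_ofReal_le hd.measurable hd.nonneg (hd.lintegral_invariant_le hlam hinv)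

lemma integral_invariant_le : ∫ x, V x ∂π ≤ (K - lam) / (1 - lam) := by
  have hX : Nonempty X := nonempty_of_isProbabilityMeasure π
  refine integral_le_of_lintegral_ofReal_le hd.measurable hd.nonneg
    (div_nonneg ?_ ?_) (hd.lintegral_invariant_le hlam hinv)
  all_goals linarith [hd.lam_lt_one, hd.one_le_K hlam]

/-- If `π C = 0`, the drift would hold almost everywhere and invariance would give `∫ V ≤ lam ∫ V`,
although `1 ≤ ∫ V < ∞`. -/
lemma measure_set_ne_zero : π C ≠ 0 := by
  intro hC
  have hi := hd.integrable_invariant hlam hinv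
  have h1 : ∫ x, V x ∂π ≤ lam * ∫ x, V x ∂π := by
    conv_lhs => rw [← integral_kernelAct hinv hi]
    rw [← integral_const_mul]
    refine integral_mono_of_nonneg (.of_forall fun y => integral_nonneg hd.nonneg)
      (hi.const_mul _) ?_
    filter_upwards [measure_eq_zero_iff_ae_notMem.1 hC] with x hx
    exact hd.integral_le_of_notMem hlam hx
  have h2 : (1 : ℝ) ≤ ∫ x, V x ∂π := by
    have := integral_mono (μ := π) (integrable_const (1 : ℝ)) hi hd.one_le
    simpa using this
  nlinarith [hd.lam_lt_one]

end IsDriftFunction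

/-- The minorizing measure has a bounded density with respect to the invariant measure. -/
lemma IsSmallSet.exists_density [IsMarkovKernel P] {ν π : Measure X} [IsProbabilityMeasure π]
    {m : ℕ} {ε : ℝ} (hs : IsSmallSet P C ν m ε) (hinv : Kernel.Invariant P π) (hC : π C ≠ 0) :
    ∃ h : X → ℝ, BddMeas h ∧ (∀ x, 0 ≤ h x) ∧
      ∀ f : X → ℝ, ∫ x, f x ∂ν = ∫ x, h x * f x ∂π := by
  have := hs.isProbabilityMeasure
  set a : ℝ≥0∞ := ENNReal.ofReal ε * π C with ha
  have ha0 : a ≠ 0 := mul_ne_zero (by simpa using hs.eps_pos) hC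
  have hat : a ≠ ∞ := ENNReal.mul_ne_top ENNReal.ofReal_ne_top (measure_ne_top _ _)
  -- Integrate the minorization over `C` and use invariance of `π` under `P^m`.
  have hle : ∀ S, MeasurableSet S → ν S ≤ a⁻¹ * π S := by
    intro S hS
    have h1 : a * ν S ≤ π S := by
      conv_rhs => rw [← (invariant_pow hinv m).def,
        Measure.bind_apply hS (Kernel.aemeasurable _)]
      calc a * ν S = ∫⁻ _ in C, ENNReal.ofReal ε * ν S ∂π := by
            rw [setLIntegral_const, ha]; ring
        _ ≤ ∫⁻ x in C, (P ^ m) x S ∂π :=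
            setLIntegral_mono' hs.measurableSet fun x hx => hs.minorization x hx S hS
        _ ≤ _ := setLIntegral_le_lintegral _ _
    calc ν S = a⁻¹ * (a * ν S) := by
          rw [← mul_assoc, ENNReal.inv_mul_cancel ha0 hat, one_mul]
      _ ≤ a⁻¹ * π S := by gcongr
  have hac : ν ≪ π := Measure.AbsolutelyContinuous.mk fun S hS h0 => by
    have := hle S hS
    rwa [h0, mul_zero, nonpos_iff_eq_zero] at this
  have hbound : ν.rnDeriv π ≤ᵐ[π] fun _ => a⁻¹ := by
    refine ae_le_of_forall_setLIntegral_le_of_sigmaFinite (Measure.measurable_rnDeriv _ _)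
      fun S hS _ => ?_
    rw [Measure.setLIntegral_rnDeriv hac, setLIntegral_const]
    exact hle S hS
  -- Truncating at the almost sure bound makes the density bounded everywhere.
  refine ⟨fun x => min (ν.rnDeriv π x).toReal a⁻¹.toReal, BddMeas.of_mem_Icc (a := 0)
    (b := a⁻¹.toReal) ((Measure.measurable_rnDeriv _ _).ennreal_toReal.min measurable_const)
    fun x => ⟨le_min ENNReal.toReal_nonneg ENNReal.toReal_nonneg, min_le_right _ _⟩,
    fun x => le_min ENNReal.toReal_nonneg ENNReal.toReal_nonneg, fun f => ?_⟩
  rw [← integral_rnDeriv_smul hac]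
  refine integral_congr_ae ?_
  filter_upwards [hbound] with x hx
  rw [smul_eq_mul, min_eq_left (ENNReal.toReal_mono (ENNReal.inv_ne_top.2 ha0) hx)]

lemma integrable_rpow_of_one_le {μ : Measure X} {p : ℝ} (hp : p ≤ 1) (hV : Measurable V)
    (hV1 : ∀ x, 1 ≤ V x) (hi : Integrable V μ) : Integrable (fun x => V x ^ p) μ := by
  refine hi.mono (hV.pow_const _).aestronglyMeasurable (.of_forall fun x => ?_)
  have h0 : 0 ≤ V x := zero_le_one.trans (hV1 x)
  rw [Real.norm_of_nonneg (Real.rpow_nonneg h0 _), Real.norm_of_nonneg h0]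
  calc V x ^ p ≤ V x ^ (1 : ℝ) := Real.rpow_le_rpow_of_exponent_le (hV1 x) hp
    _ = V x := Real.rpow_one _

/-- Jensen's inequality for `u ↦ u ^ p`, `0 ≤ p ≤ 1`. -/
lemma integral_rpow_le {μ : Measure X} [IsFiniteMeasure μ] {p c : ℝ} (hp0 : 0 ≤ p) (hp : p ≤ 1)
    (hc : 0 < c) (hV : Measurable V) (hV1 : ∀ x, 1 ≤ V x) (hi : Integrable V μ)
    (hle : ∫ x, V x ∂μ ≤ c * μ.real Set.univ) :
    ∫ x, V x ^ p ∂μ ≤ c ^ p * μ.real Set.univ := by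
  -- The tangent line of `u ↦ u ^ p` at `c`, from weighted AM–GM; it needs no normalization of `μ`.
  have hpt : ∀ x, V x ^ p ≤ c ^ (p - 1) * (p * V x + (1 - p) * c) := fun x => by
    have h := Real.geom_mean_le_arith_mean2_weighted hp0 (sub_nonneg.2 hp)
      (zero_le_one.trans (hV1 x)) hc.le (by ring)
    calc V x ^ p = c ^ (p - 1) * (V x ^ p * c ^ (1 - p)) := by
          rw [mul_left_comm, ← Real.rpow_add hc]
          simp
      _ ≤ _ := by gcongr
  calc ∫ x, V x ^ p ∂μ ≤ ∫ x, c ^ (p - 1) * (p * V x + (1 - p) * c) ∂μ :=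
        integral_mono (integrable_rpow_of_one_le hp hV hV1 hi)
          (((hi.const_mul _).add (integrable_const _)).const_mul _) hpt
    _ = c ^ (p - 1) * (p * ∫ x, V x ∂μ + (1 - p) * c * μ.real Set.univ) := by
        rw [integral_const_mul, integral_add (hi.const_mul _) (integrable_const _),
          integral_const_mul, integral_const, smul_eq_mul, mul_comm (μ.real _)]
    _ ≤ c ^ (p - 1) * (p * (c * μ.real Set.univ) + (1 - p) * c * μ.real Set.univ) := by gcongr
    _ = c ^ (p - 1 + 1) * μ.real Set.univ := by rw [Real.rpow_add_one hc.ne']; ring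
    _ = _ := by rw [sub_add_cancel]

end Drift

/-! ### The constants `B`, `rho`, `r` and `D`. -/

section Parameters

variable {lam K ε : ℝ} {m : ℕ}

lemma one_le_B (hlam : 0 < lam) (hlam1 : lam < 1) (hK : 1 ≤ K) : 1 ≤ B lam K m := by
  have h1 : 0 < 1 - lam := by linarith
  have h2 : 0 ≤ 1 - lam ^ m := sub_nonneg.2 (pow_le_one₀ hlam.le hlam1.le)
  have h3 : (1 - lam ^ m) / (1 - lam) * (1 - lam) ≤ (1 - lam ^ m) / (1 - lam) * (K - lam) := by
    gcongr
  rw [div_mul_cancel₀ _ h1.ne'] at h3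
  rw [B]
  linarith

/-- The exponent in the definition of `rho` has a positive denominator and is negative. -/
lemma rho_exponent_neg (hlam : 0 < lam) (hlam1 : lam < 1) (hK : 1 ≤ K) (hm : 1 ≤ m) (hε : 0 < ε)
    (hε1 : ε < 1) : 0 < -(m : ℝ) * Real.log lam + Real.log (B lam K m - ε) - Real.log (1 - ε) ∧
      (-Real.log (1 - ε) * Real.log lam) /
        (-(m : ℝ) * Real.log lam + Real.log (B lam K m - ε) - Real.log (1 - ε)) < 0 := by
  have hL : Real.log lam < 0 := Real.log_neg hlam hlam1
  have hl : Real.log (1 - ε) < 0 := Real.log_neg (by linarith) (by linarith)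
  have hb : Real.log (1 - ε) ≤ Real.log (B lam K m - ε) :=
    Real.log_le_log (by linarith) (by linarith [one_le_B (m := m) hlam hlam1 hK])
  have hm' : (1 : ℝ) ≤ m := by exact_mod_cast hm
  have hden : 0 < -(m : ℝ) * Real.log lam + Real.log (B lam K m - ε) - Real.log (1 - ε) := by
    nlinarith
  exact ⟨hden, div_neg_of_neg_of_pos (by nlinarith) hden⟩

lemma lam_le_rho : lam ≤ rho lam K m ε := by
  rw [rho]
  split_ifs
  · exact le_rfl
  · exact le_max_left _ _

lemma rho_lt_one (hlam : 0 < lam) (hlam1 : lam < 1) (hK : 1 ≤ K) (hm : 1 ≤ m) (hε : 0 < ε)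
    (hε1 : ε ≤ 1) : rho lam K m ε < 1 := by
  rw [rho]
  split_ifs with h
  · exact hlam1
  · exact max_lt hlam1 (Real.exp_lt_one_iff.2
      (rho_exponent_neg hlam hlam1 hK hm hε (lt_of_le_of_ne hε1 h)).2)

lemma r_mem_Ioc (hlam : 0 < lam) (hlam1 : lam < 1) (hK : 1 ≤ K) (hm : 1 ≤ m) (hε : 0 < ε)
    (hε1 : ε ≤ 1) : r lam K m ε ∈ Set.Ioc 0 1 := by
  have hL : Real.log lam < 0 := Real.log_neg hlam hlam1
  have h1 := rho_lt_one hlam hlam1 hK hm hε hε1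
  have h2 : lam ≤ rho lam K m ε := lam_le_rho
  rw [r]
  split_ifs with h
  · simp
  · refine ⟨div_pos_of_neg_of_neg (Real.log_neg (hlam.trans_le h2) h1) hL, ?_⟩
    rw [div_le_one_of_neg hL]
    exact Real.log_le_log hlam h2

lemma lam_rpow_r (hlam : 0 < lam) (hlam1 : lam < 1) : lam ^ r lam K m ε = rho lam K m ε := by
  have hL : Real.log lam < 0 := Real.log_neg hlam hlam1
  have h2 : lam ≤ rho lam K m ε := lam_le_rho
  by_cases h : ε = 1
  · rw [r, rho, if_pos h, if_pos h, Real.rpow_one]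
  · rw [Real.rpow_def_of_pos hlam, r, if_neg h, mul_div_cancel₀ _ hL.ne,
      Real.exp_log (hlam.trans_le h2)]

/-- This inequality explains `rho`. Since `rho = lam ^ r`, taking logarithms turns it into `r * den
≤ -log (1 - ε)`; equality is the second entry of the maximum defining `rho`, and a larger `rho`
means a smaller `r`. -/
lemma residual_rpow_le (hlam : 0 < lam) (hlam1 : lam < 1) (hK : 1 ≤ K) (hm : 1 ≤ m) (hε : 0 < ε)
    (hε1 : ε < 1) :
    ((B lam K m - ε) / (1 - ε)) ^ r lam K m ε * (1 - ε) ≤ rho lam K m ε ^ m := by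
  have hL : Real.log lam < 0 := Real.log_neg hlam hlam1
  have hB := one_le_B (m := m) hlam hlam1 hK
  have hrho : 0 < rho lam K m ε := hlam.trans_le lam_le_rho
  obtain ⟨hden, -⟩ := rho_exponent_neg hlam hlam1 hK hm hε hε1
  set den := -(m : ℝ) * Real.log lam + Real.log (B lam K m - ε) - Real.log (1 - ε) with hden_def
  set e := (-Real.log (1 - ε) * Real.log lam) / den with he
  have h1 : e ≤ Real.log (rho lam K m ε) := by
    rw [Real.le_log_iff_exp_le hrho, rho, if_neg hε1.ne]
    exact le_max_right _ _
  have h2 : r lam K m ε * Real.log lam = Real.log (rho lam K m ε) := by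
    rw [r, if_neg hε1.ne, div_mul_cancel₀ _ hL.ne]
  have h3 : r lam K m ε * den ≤ -Real.log (1 - ε) := by
    have h4 : e * den = -Real.log (1 - ε) * Real.log lam := div_mul_cancel₀ _ hden.ne'
    have h5 : e * den ≤ r lam K m ε * Real.log lam * den := by rw [h2]; gcongr
    nlinarith
  have h6 : 0 < (B lam K m - ε) / (1 - ε) := div_pos (by linarith) (by linarith)
  rw [← Real.log_le_log_iff (mul_pos (Real.rpow_pos_of_pos h6 _) (by linarith)) (by positivity),
    Real.log_mul (Real.rpow_pos_of_pos h6 _).ne' (by linarith), Real.log_rpow h6,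
    Real.log_div (by linarith) (by linarith), Real.log_pow, ← h2]
  rw [hden_def] at h3
  linarith

/-- The renewal argument yields the left side; `D` has an extra factor under the root, at least `1`
because `B ≥ 1` and `m ≥ 1`. -/
lemma half_sqrt_le_D (hlam : 0 < lam) (hlam1 : lam < 1) (hK : 1 ≤ K) (hm : 1 ≤ m) (hε : 0 < ε)
    (hε1 : ε ≤ 1) :
    1 / 2 * Real.sqrt (rho lam K m ε / (1 - rho lam K m ε)) ≤ D lam K m ε := by
  have hrho : 0 < rho lam K m ε := hlam.trans_le lam_le_rho
  have hrho1 := rho_lt_one hlam hlam1 hK hm hε hε1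
  have hB := one_le_B (m := m) hlam hlam1 hK
  have h1 : 0 < 1 - rho lam K m ε := by linarith
  have h2 : 1 ≤ ((B lam K m - (1 - ε)) / ε) ^ r lam K m ε :=
    Real.one_le_rpow ((one_le_div hε).2 (by linarith)) (r_mem_Ioc hlam hlam1 hK hm hε hε1).1.le
  have h3 : rho lam K m ε ≤ rho lam K m ε ^ (2 - (m : ℤ)) := by
    conv_lhs => rw [← zpow_one (rho lam K m ε)]
    exact zpow_le_zpow_right_of_le_one₀ hrho hrho1.le (by omega)
  rw [D]
  gcongr
  calc rho lam K m ε / (1 - rho lam K m ε)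
      ≤ 1 * (rho lam K m ε ^ (2 - (m : ℤ)) / (1 - rho lam K m ε)) := by rw [one_mul]; gcongr
    _ ≤ _ := by gcongr

end Parameters

/-! ### Convergence from `ν`, from a point, and in the `V`-norm. -/

section Convergence

open Finset Filter Topology

variable {X : Type*} [MeasurableSpace X] {P : Kernel X X} [IsMarkovKernel P] {C : Set X}
  {V : X → ℝ} {lam K : ℝ} {ν : Measure X} {m : ℕ} {ε : ℝ}

/-- The decomposition `sum_tail_sub_mul_le` for a random starting point. -/
lemma sum_integral_tail_sub_mul_le (hs : IsSmallSet P C ν m ε) {f : X → ℝ} (hf : BddMeas f)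
    (hf0 : ∀ x, 0 ≤ f x) (μ : Measure X) [IsFiniteMeasure μ] (t : ℕ) :
    ∑ s ∈ range t, (∫ x, tail P C ν m ε s x ∂μ - ∫ x, tail P C ν m ε (s + 1) x ∂μ) *
      ∫ y, kernelAct (P ^ (t - 1 - s)) f y ∂ν ≤ ∫ x, kernelAct (P ^ t) f x ∂μ := by
  have hint : ∀ (s : ℕ) (c : ℝ), Integrable (fun y =>
      (tail P C ν m ε s y - tail P C ν m ε (s + 1) y) * c) μ := fun s c =>
    ((((bddMeas_tail hs s).sub (bddMeas_tail hs (s + 1))).mul (.const c)).integrable μ)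
  calc _ = ∫ x, ∑ s ∈ range t, (tail P C ν m ε s x - tail P C ν m ε (s + 1) x) *
          ∫ y, kernelAct (P ^ (t - 1 - s)) f y ∂ν ∂μ := by
        rw [integral_finsetSum _ fun s _ => hint s _]
        refine sum_congr rfl fun s _ => ?_
        rw [integral_mul_const, integral_sub ((bddMeas_tail hs s).integrable μ)
          ((bddMeas_tail hs (s + 1)).integrable μ)]
    _ ≤ _ := integral_mono (integrable_finsetSum _ fun s _ => hint s _)
          (hf.kernelAct.integrable _) (sum_tail_sub_mul_le hs hf hf0 t)

lemma tail_le_rho_zpow_mul [Nonempty X] (hlam : 0 < lam) (hd : IsDriftFunction P C V lam K)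
    (hs : IsSmallSet P C ν m ε) (t : ℕ) (x : X) :
    tail P C ν m ε t x ≤ rho lam K m ε ^ ((t : ℤ) + 1 - m) * V x ^ r lam K m ε := by
  have := hs.isProbabilityMeasure
  have hK := hd.one_le_K hlam
  have hlam1 := hd.lam_lt_one
  obtain ⟨x₀, hx₀⟩ := hd.nonempty_set hlam
  have hε1 := hs.eps_le_one hx₀
  have hε := hs.eps_pos
  have hm := hs.one_le_m
  have hrho : 0 < rho lam K m ε := hlam.trans_le lam_le_rho
  have hrho1 := rho_lt_one hlam hlam1 hK hm hε hε1
  obtain ⟨hr0, hr1⟩ := r_mem_Ioc hlam hlam1 hK hm hε hε1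
  have hVi := hd.integrable_pow hlam
  refine tail_le_zpow_mul hs hrho hrho1.le (fun x => Real.one_le_rpow (hd.one_le x) hr0.le)
    (fun t x => integrable_rpow_of_one_le hr1 hd.measurable hd.one_le (hVi t x)) ?_ ?_ t x
  · intro x hx
    have hVx : 0 < V x := zero_lt_one.trans_le (hd.one_le x)
    have h := integral_rpow_le hr0.le hr1 (mul_pos hlam hVx) hd.measurable hd.one_le
      (hd.integrable_kernel hlam x)
      (by rw [probReal_univ, mul_one]; exact hd.integral_le_of_notMem hlam hx)
    rwa [probReal_univ, mul_one, Real.mul_rpow hlam.le hVx.le, lam_rpow_r hlam hlam1] at h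
  · intro x hx
    obtain ⟨R, hR, hRi⟩ := hs.exists_residual hx
    have hU := integrable_rpow_of_one_le hr1 hd.measurable hd.one_le (hVi m x)
    rw [(hRi _ hU).2.2, add_sub_cancel_left]
    have hmass := (hRi (fun _ => 1) (integrable_const _)).2.2
    simp only [integral_const, smul_eq_mul, mul_one, probReal_univ] at hmass
    have hmass' : R.real Set.univ = 1 - ε := by linarith
    -- For `ε = 1` the residual measure vanishes; otherwise Jensen is applied to it with mean `(B -
    -- ε)/(1 - ε)`, using `∫ V dν ≥ 1`.
    rcases hε1.eq_or_lt with h1 | h1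
    · have hR0 : R = 0 := by
        rw [h1, sub_self, measureReal_eq_zero_iff] at hmass'
        exact Measure.measure_univ_eq_zero.1 hmass'
      rw [hR0, integral_zero_measure]
      positivity
    · obtain ⟨hVν, hVR, hVe⟩ := hRi V (hVi m x)
      have hν1 : 1 ≤ ∫ y, V y ∂ν := by
        have := integral_mono (μ := ν) (integrable_const (1 : ℝ)) hVν hd.one_le
        simpa using this
      have hB := one_le_B (m := m) hlam hlam1 hK
      have hVRle : ∫ y, V y ∂(R) ≤ (B lam K m - ε) / (1 - ε) * R.real Set.univ := by
        rw [hmass', div_mul_cancel₀ _ (by linarith)]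
        nlinarith [hd.integral_pow_le_B hlam hm hx]
      have h := integral_rpow_le hr0.le hr1 (div_pos (by linarith) (by linarith)) hd.measurable
        hd.one_le hVR hVRle
      rw [hmass'] at h
      exact h.trans (residual_rpow_le hlam hlam1 hK hm hε h1)

variable {π : Measure X} [IsProbabilityMeasure π]

lemma one_le_integral_sq {g : X → ℝ} (hg : BddMeas g) (hg1 : ∫ x, g x ∂π = 1) :
    1 ≤ ∫ x, g x ^ 2 ∂π := by
  have h0 : 0 ≤ ∫ x, (g x - 1) ^ 2 ∂π := integral_nonneg fun x => sq_nonneg _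
  have : ∀ x, (g x - 1) ^ 2 = g x * g x - (2 * g x - 1) := fun x => by ring
  simp only [this] at h0
  rw [integral_sub_sub_const ((hg.mul hg).integrable π) ((hg.integrable π).const_mul _),
    integral_const_mul, hg1] at h0
  simp only [← sq] at h0
  linarith

/-- Convergence of the chain started from the minorizing measure. -/
lemma abs_integral_kernelAct_pow_sub_le (hrev : Kernel.IsReversible P π)
    (hspec : HasNonnegEigenvalues P π hrev) (hlam : 0 < lam)
    (hd : IsDriftFunction P C V lam K) (hs : IsSmallSet P C ν m ε) {f : X → ℝ}
    (hf : Measurable f) (hf01 : ∀ x, f x ∈ Set.Icc (0 : ℝ) 1) (k : ℕ) :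
    |∫ x, kernelAct (P ^ k) f x ∂ν - ∫ x, f x ∂π| ≤ D lam K m ε * rho lam K m ε ^ k := by
  have hX : Nonempty X := nonempty_of_isProbabilityMeasure π
  have := hs.isProbabilityMeasure
  have hK := hd.one_le_K hlam
  have hlam1 := hd.lam_lt_one
  have hinv := hrev.invariant
  obtain ⟨x₀, hx₀⟩ := hd.nonempty_set hlam
  have hε1 := hs.eps_le_one hx₀
  have hε := hs.eps_pos
  have hm := hs.one_le_m
  have hrho : 0 < rho lam K m ε := hlam.trans_le lam_le_rho
  have hrho1 := rho_lt_one hlam hlam1 hK hm hε hε1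
  obtain ⟨hr0, hr1⟩ := r_mem_Ioc hlam hlam1 hK hm hε hε1
  obtain ⟨h, hb, hh0, hν⟩ := hs.exists_density hinv (hd.measure_set_ne_zero hlam hinv)
  have hVν : Integrable V ν := by
    obtain ⟨R, -, hRi⟩ := hs.exists_residual hx₀
    exact (hRi V (hd.integrable_pow hlam m x₀)).1
  have htail : ∀ (μ : Measure X) [IsFiniteMeasure μ], Integrable V μ → ∀ n : ℕ,
      ∫ x, tail P C ν m ε n x ∂μ ≤
        (rho lam K m ε ^ (1 - (m : ℤ)) * ∫ x, V x ^ r lam K m ε ∂μ) * rho lam K m ε ^ n := by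
    intro μ _ hVμ n
    calc ∫ x, tail P C ν m ε n x ∂μ
        ≤ ∫ x, rho lam K m ε ^ ((n : ℤ) + 1 - m) * V x ^ r lam K m ε ∂μ :=
          integral_mono ((bddMeas_tail hs n).integrable μ)
            ((integrable_rpow_of_one_le hr1 hd.measurable hd.one_le hVμ).const_mul _)
            (tail_le_rho_zpow_mul hlam hd hs n)
      _ = _ := by
          rw [integral_const_mul, add_sub_assoc, zpow_add₀ hrho.ne', zpow_natCast]
          ring
  have hh1 : ∫ x, h x ∂π = 1 := by
    have := hν fun _ => 1
    simpa using this.symm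
  have hh1k : ∀ j : ℕ, ∫ x, kernelAct (P ^ j) h x ∂π = 1 := fun j => by
    rw [integral_kernelAct (invariant_pow hinv j) (hb.integrable π), hh1]
  set b : ℕ → ℝ := fun k => ∫ x, h x * kernelAct (P ^ k) h x ∂π with hb_def
  have hbν : ∀ j, ∫ x, kernelAct (P ^ j) h x ∂ν = b j := fun j => hν _
  have hanti : Antitone b := integral_mul_kernelAct_pow_antitone hrev hspec hb
  -- At even indices `b` is the squared norm of a density of mean one; monotonicity gives the rest.
  have hb1 : ∀ j, 1 ≤ b j := fun j => by
    refine le_trans ?_ (hanti (by omega : j ≤ 2 * j))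
    rw [hb_def]
    dsimp only
    rw [integral_mul_kernelAct_pow_two_mul hrev hb]
    exact one_le_integral_sq hb.kernelAct (hh1k j)
  have hlim : Tendsto b atTop (𝓝 1) := by
    have hlim' := tendsto_atTop_ciInf hanti ⟨1, by rintro _ ⟨j, rfl⟩; exact hb1 j⟩
    set β := ⨅ j, b j
    have hβ1 : 1 ≤ β := le_ciInf hb1
    have hβb : ∀ j, β ≤ b j := fun j => ciInf_le ⟨1, by rintro _ ⟨j, rfl⟩; exact hb1 j⟩ j
    -- Started from `π`, the density has mean `1` at all times, while regeneration by time `t`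
    -- contributes at least its probability times `β`. As that probability tends to `1`, `β ≤ 1`.
    have hle : ∀ t, (1 - ∫ x, tail P C ν m ε t x ∂π) * β ≤ 1 := by
      intro t
      have h1 := sum_integral_tail_sub_mul_le hs hb hh0 π t
      rw [hh1k] at h1
      refine le_trans ?_ h1
      have h2 : (1 - ∫ x, tail P C ν m ε t x ∂π) = ∑ s ∈ range t,
          (∫ x, tail P C ν m ε s x ∂π - ∫ x, tail P C ν m ε (s + 1) x ∂π) := by
        rw [sum_range_sub']
        simp [tail_zero]
      rw [h2, sum_mul]
      refine sum_le_sum fun s _ => ?_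
      rw [hbν]
      refine mul_le_mul_of_nonneg_left (hβb _) (sub_nonneg.2 ?_)
      exact integral_mono ((bddMeas_tail hs _).integrable π) ((bddMeas_tail hs _).integrable π)
        (tail_succ_le hs s)
    have htail0 : Tendsto (fun t => ∫ x, tail P C ν m ε t x ∂π) atTop (𝓝 0) := by
      refine squeeze_zero (fun t => integral_nonneg (tail_nonneg hs t))
        (htail π (hd.integrable_invariant hlam hinv)) ?_
      simpa using (tendsto_pow_atTop_nhds_zero_of_lt_one hrho.le hrho1).const_mul
        (rho lam K m ε ^ (1 - (m : ℤ)) * ∫ x, V x ^ r lam K m ε ∂π)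
    have hβ : (1 - 0) * β ≤ 1 := le_of_tendsto' ((htail0.const_sub 1).mul_const β) hle
    have : β = 1 := le_antisymm (by linarith) hβ1
    rwa [this] at hlim'
  have hren := sub_one_le_of_renewal (q := fun n => ∫ x, tail P C ν m ε n x ∂ν) (b := b)
    (fun n => integral_nonneg (tail_nonneg hs n)) (by simp [tail_zero]) hanti hlim
    (fun t => by simpa only [hbν] using sum_integral_tail_sub_mul_le hs hb hh0 ν t)
    hrho hrho1 (htail ν hVν) (2 * k)
  -- Reversibility moves `P^k` onto `h`, so `P^k h` is the density of `νP^k`.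
  rw [hν, integral_mul_kernelAct_pow_comm hrev hb (.of_mem_Icc hf hf01)]
  refine (abs_integral_mul_sub_le hb.kernelAct (hh1k k) hf hf01).trans ?_
  rw [← integral_mul_kernelAct_pow_two_mul hrev hb]
  calc 1 / 2 * Real.sqrt (b (2 * k) - 1)
      ≤ 1 / 2 * Real.sqrt ((rho lam K m ε ^ k) ^ 2 *
          (rho lam K m ε / (1 - rho lam K m ε))) := by
        rw [← pow_mul, mul_comm k 2]
        gcongr
    _ = 1 / 2 * Real.sqrt (rho lam K m ε / (1 - rho lam K m ε)) * rho lam K m ε ^ k := by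
        rw [Real.sqrt_mul (sq_nonneg _), Real.sqrt_sq (by positivity)]
        ring
    _ ≤ D lam K m ε * rho lam K m ε ^ k := by
        gcongr
        exact half_sqrt_le_D hlam hlam1 hK hm hε hε1

/-- The total variation bound, for functions with values in `[0,1]`. -/
lemma abs_kernelAct_pow_sub_le (hrev : Kernel.IsReversible P π)
    (hspec : HasNonnegEigenvalues P π hrev) (hlam : 0 < lam)
    (hd : IsDriftFunction P C V lam K) (hs : IsSmallSet P C ν m ε) {f : X → ℝ}
    (hf : Measurable f) (hf01 : ∀ x, f x ∈ Set.Icc (0 : ℝ) 1) (x : X) (t : ℕ) :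
    |∫ y, f y ∂((P ^ t) x) - ∫ y, f y ∂π| ≤
      (F₁ V lam K m ε x * t + F₀ V lam K m ε x) * rho lam K m ε ^ t := by
  have hX : Nonempty X := nonempty_of_isProbabilityMeasure π
  have := hs.isProbabilityMeasure
  have hfb := BddMeas.of_mem_Icc hf hf01
  have hlam1 := hd.lam_lt_one
  obtain ⟨x₀, hx₀⟩ := hd.nonempty_set hlam
  have hrho : 0 < rho lam K m ε := hlam.trans_le lam_le_rho
  have hrho1 := rho_lt_one hlam hlam1 (hd.one_le_K hlam) hs.one_le_m hs.eps_pos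
    (hs.eps_le_one hx₀)
  have hQ := fun s : ℕ => tail_le_rho_zpow_mul hlam hd hs s x
  have hQ0 := fun s : ℕ => tail_nonneg hs s x
  have hQd := fun s : ℕ => tail_succ_le hs s x
  have hn := abs_integral_kernelAct_pow_sub_le hrev hspec hlam hd hs hf hf01
  have hU : 0 ≤ V x ^ r lam K m ε := Real.rpow_nonneg (hd.nonneg x) _
  have hD : 0 ≤ D lam K m ε := by rw [D]; positivity
  set Q : ℕ → ℝ := fun s => tail P C ν m ε s x with hQ_def
  set n : ℕ → ℝ := fun k => ∫ y, kernelAct (P ^ k) f y ∂ν with hn_def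
  set p := ∫ y, f y ∂π
  have hp0 : 0 ≤ p := integral_nonneg fun y => (hf01 y).1
  have hp1 : p ≤ 1 := by
    have := integral_mono (hfb.integrable π) (integrable_const (1 : ℝ)) fun y => (hf01 y).2
    simpa using this
  have hΔ : ∑ s ∈ range t, (Q s - Q (s + 1)) = 1 - Q t := by
    rw [sum_range_sub']
    simp only [hQ_def, tail_zero]
  have hlow : ∑ s ∈ range t, (Q s - Q (s + 1)) * n (t - 1 - s) ≤ ∫ y, f y ∂((P ^ t) x) :=
    sum_tail_sub_mul_le hs hfb (fun y => (hf01 y).1) t x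
  -- The upper bound is the lower bound applied to `1 - f`.
  have hupp : ∫ y, f y ∂((P ^ t) x) ≤
      ∑ s ∈ range t, (Q s - Q (s + 1)) * n (t - 1 - s) + Q t := by
    have hcompl : ∀ (j : ℕ) (y : X),
        kernelAct (P ^ j) (fun z => 1 - f z) y = 1 - kernelAct (P ^ j) f y := fun j y => by
      rw [kernelAct, integral_sub (integrable_const _) (hfb.integrable _)]
      simp [kernelAct]
    have hcn : ∀ j : ℕ, ∫ y, kernelAct (P ^ j) (fun z => 1 - f z) y ∂ν = 1 - n j := fun j => by
      simp only [hcompl]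
      rw [integral_sub (integrable_const _) (hfb.kernelAct.integrable _)]
      simp [hn_def]
    have h := sum_tail_sub_mul_le hs ((BddMeas.const 1).sub hfb)
      (fun y => sub_nonneg.2 (hf01 y).2) t x
    rw [hcompl] at h
    simp only [hcn, mul_sub, mul_one, sum_sub_distrib] at h
    change ∑ s ∈ range t, Q s - ∑ s ∈ range t, Q (s + 1) -
      ∑ s ∈ range t, (Q s - Q (s + 1)) * n (t - 1 - s) ≤ 1 - ∫ y, f y ∂((P ^ t) x) at h
    rw [← sum_sub_distrib, hΔ] at h
    linarith
  have hmid : |∑ s ∈ range t, (Q s - Q (s + 1)) * n (t - 1 - s) - (1 - Q t) * p| ≤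
      ∑ s ∈ range t, (Q s - Q (s + 1)) * (D lam K m ε * rho lam K m ε ^ (t - 1 - s)) := by
    rw [← hΔ, sum_mul, ← sum_sub_distrib]
    refine (abs_sum_le_sum_abs _ _).trans (sum_le_sum fun s _ => ?_)
    rw [← mul_sub, abs_mul, abs_of_nonneg (sub_nonneg.2 (hQd s))]
    exact mul_le_mul_of_nonneg_left (hn _) (sub_nonneg.2 (hQd s))
  have hfirst : |∫ y, f y ∂((P ^ t) x) - p| ≤
      ∑ s ∈ range t, (Q s - Q (s + 1)) * (D lam K m ε * rho lam K m ε ^ (t - 1 - s)) + Q t := by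
    have h1 := abs_le.1 hmid
    have h2 := hQ0 t
    have h3 : 0 ≤ Q t * p := mul_nonneg h2 hp0
    have h4 : Q t * p ≤ Q t := mul_le_of_le_one_right h2 hp1
    rw [abs_le]
    constructor <;> linarith [h1.1, h1.2]
  refine hfirst.trans ?_
  -- After summation by parts, the boundary terms with the extra `Q t` give `D ρ^t + Q t (1 - D)`,
  -- hence `F₀`; each of the `t` terms left is at most `F₁ ρ^t`.
  rw [sum_range_sub_mul_reflect Q (fun k => D lam K m ε * rho lam K m ε ^ k)]
  have hQ00 : Q 0 = 1 := tail_zero x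
  have hsum : ∑ s ∈ range t, Q s * (D lam K m ε * rho lam K m ε ^ (t - 1 - s) -
      D lam K m ε * rho lam K m ε ^ (t - s)) ≤
        F₁ V lam K m ε x * t * rho lam K m ε ^ t := by
    have hterm : ∀ s ∈ range t, Q s * (D lam K m ε * rho lam K m ε ^ (t - 1 - s) -
        D lam K m ε * rho lam K m ε ^ (t - s)) ≤ F₁ V lam K m ε x * rho lam K m ε ^ t := by
      intro s hst
      have hst' := mem_range.1 hst
      have e1 : D lam K m ε * rho lam K m ε ^ (t - 1 - s) - D lam K m ε * rho lam K m ε ^ (t - s)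
          = D lam K m ε * (1 - rho lam K m ε) * rho lam K m ε ^ (t - 1 - s) := by
        rw [show t - s = t - 1 - s + 1 by omega, pow_succ]
        ring
      have e2 : rho lam K m ε ^ ((s : ℤ) + 1 - m) * rho lam K m ε ^ (t - 1 - s) =
          rho lam K m ε ^ (-(m : ℤ)) * rho lam K m ε ^ t := by
        rw [← zpow_natCast _ (t - 1 - s), ← zpow_natCast _ t, ← zpow_add₀ hrho.ne',
          ← zpow_add₀ hrho.ne']
        congr 1
        omega
      have h0 : 0 ≤ D lam K m ε * (1 - rho lam K m ε) * rho lam K m ε ^ (t - 1 - s) :=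
        mul_nonneg (mul_nonneg hD (by linarith)) (by positivity)
      rw [e1]
      refine (mul_le_mul_of_nonneg_right (hQ s) h0).trans_eq ?_
      rw [F₁]
      linear_combination (V x ^ r lam K m ε * D lam K m ε * (1 - rho lam K m ε)) * e2
    refine (sum_le_sum hterm).trans_eq ?_
    rw [sum_const, card_range, nsmul_eq_mul]
    ring
  have hlast : Q t * (1 - D lam K m ε) ≤ max (1 - D lam K m ε) 0 *
      rho lam K m ε ^ (1 - (m : ℤ)) * V x ^ r lam K m ε * rho lam K m ε ^ t := by
    have e3 : rho lam K m ε ^ ((t : ℤ) + 1 - m) =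
        rho lam K m ε ^ (1 - (m : ℤ)) * rho lam K m ε ^ t := by
      rw [add_sub_assoc, zpow_add₀ hrho.ne', zpow_natCast, mul_comm]
    calc Q t * (1 - D lam K m ε) ≤ Q t * max (1 - D lam K m ε) 0 :=
          mul_le_mul_of_nonneg_left (le_max_left _ _) (hQ0 t)
      _ ≤ rho lam K m ε ^ ((t : ℤ) + 1 - m) * V x ^ r lam K m ε * max (1 - D lam K m ε) 0 :=
          mul_le_mul_of_nonneg_right (hQ t) (le_max_right _ _)
      _ = _ := by rw [e3]; ring
  have hF₀ : F₀ V lam K m ε x * rho lam K m ε ^ t = max (1 - D lam K m ε) 0 *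
      rho lam K m ε ^ (1 - (m : ℤ)) * V x ^ r lam K m ε * rho lam K m ε ^ t +
        D lam K m ε * rho lam K m ε ^ t := by
    rw [F₀]; ring
  rw [hQ00, pow_zero, add_mul, hF₀]
  linarith

/-- A bound on the convergence of `[0,1]`-valued functions propagates, through the drift
condition, to functions dominated by `V`. -/
lemma abs_integral_pow_sub_le_of_recursion (hlam : 0 < lam) (hd : IsDriftFunction P C V lam K)
    (hinv : Kernel.Invariant P π) (x : X) {T w : ℕ → ℝ}
    (hT : ∀ t, ∀ f : X → ℝ, Measurable f → (∀ y, f y ∈ Set.Icc (0 : ℝ) 1) →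
      |∫ y, f y ∂((P ^ t) x) - ∫ y, f y ∂π| ≤ T t)
    (hw0 : w 0 = G₀ V lam K x) (hw : ∀ t, w (t + 1) = lam * w t + 2 * K * T t) (t : ℕ)
    {f : X → ℝ} (hf : Measurable f) (hfV : ∀ y, |f y| ≤ V y) :
    |∫ y, f y ∂((P ^ t) x) - ∫ y, f y ∂π| ≤ w t := by
  have hX : Nonempty X := nonempty_of_isProbabilityMeasure π
  have hK := hd.one_le_K hlam
  have hVπ := hd.integrable_invariant hlam hinv
  have hdom : ∀ {μ : Measure X} {u : X → ℝ}, Integrable V μ → Measurable u →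
      (∀ y, |u y| ≤ V y) → Integrable u μ := fun hVμ hu huV =>
    hVμ.mono' hu.aestronglyMeasurable (.of_forall huV)
  induction t generalizing f with
  | zero =>
    have h1 : ∫ y, f y ∂((P ^ 0) x) = f x := congrFun (kernelAct_pow_zero P hf) x
    have h2 : |∫ y, f y ∂π| ≤ (K - lam) / (1 - lam) :=
      (abs_integral_le_integral_abs.trans (integral_mono (hdom hVπ hf hfV).abs hVπ hfV)).trans
        (hd.integral_invariant_le hlam hinv)
    rw [h1, hw0, G₀]
    exact (abs_sub _ _).trans (add_le_add (hfV x) h2)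
  | succ t ih =>
    set g := kernelAct P f with hg
    have hgm : Measurable g :=
      (StronglyMeasurable.integral_kernel hf.stronglyMeasurable).measurable
    have h1 : ∫ y, f y ∂((P ^ (t + 1)) x) = ∫ y, g y ∂((P ^ t) x) :=
      kernelAct_pow_succ' P t (hdom (hd.integrable_pow hlam _ _) hf hfV)
    have h2 : ∫ y, f y ∂π = ∫ y, g y ∂π := (integral_kernelAct hinv (hdom hVπ hf hfV)).symm
    have hgV : ∀ y, |g y| ≤ lam * V y + K := fun y => by
      have hi := hd.integrable_kernel hlam y
      have h3 : |g y| ≤ ∫ z, V z ∂(P y) :=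
        abs_integral_le_integral_abs.trans (integral_mono (hdom hi hf hfV).abs hi hfV)
      linarith [hd.integral_le_add hlam y]
    -- Clip `g / lam` to `[-V, V]`. Since `|g| ≤ lam V + K`, the remainder is at most `K`; rescaled
    -- into `[0,1]` it is controlled by `T`, at the cost `2K`.
    set g₁ : X → ℝ := fun y => max (-V y) (min (g y / lam) (V y)) with hg₁
    have hg₁m : Measurable g₁ := hd.measurable.neg.max ((hgm.div_const _).min hd.measurable)
    have hg₁V : ∀ y, |g₁ y| ≤ V y := fun y => by
      have := hd.nonneg y
      exact abs_le.2 ⟨le_max_left _ _, max_le (by linarith) (min_le_right _ _)⟩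
    have hrest : ∀ y, |g y - lam * g₁ y| ≤ K := fun y => by
      have h4 : lam * g₁ y = max (-(lam * V y)) (min (g y) (lam * V y)) := by
        rw [hg₁, mul_max_of_nonneg _ _ hlam.le, mul_min_of_nonneg _ _ hlam.le,
          mul_div_cancel₀ _ hlam.ne', mul_neg]
      have h5 := abs_le.1 (hgV y)
      have h6 : 0 ≤ lam * V y := mul_nonneg hlam.le (hd.nonneg y)
      rw [h4, abs_le]
      rcases max_cases (-(lam * V y)) (min (g y) (lam * V y)) with h | h <;>
        rcases min_cases (g y) (lam * V y) with h' | h' <;> constructor <;> linarith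
    set f' : X → ℝ := fun y => (g y - lam * g₁ y + K) / (2 * K) with hf'
    have hf'm : Measurable f' := ((hgm.sub (hg₁m.const_mul _)).add_const _).div_const _
    have hf'01 : ∀ y, f' y ∈ Set.Icc (0 : ℝ) 1 := fun y => by
      have h7 := abs_le.1 (hrest y)
      exact ⟨div_nonneg (by linarith) (by linarith), (div_le_one (by linarith)).2 (by linarith)⟩
    have hsplit : ∀ (μ : Measure X) [IsProbabilityMeasure μ], Integrable V μ →
        ∫ y, g y ∂μ = lam * ∫ y, g₁ y ∂μ + (2 * K * ∫ y, f' y ∂μ - K) := by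
      intro μ _ hVμ
      have i1 := hdom hVμ hg₁m hg₁V
      have i2 := (BddMeas.of_mem_Icc hf'm hf'01).integrable μ
      have hpt : ∀ y, g y = lam * g₁ y - (-(2 * K) * f' y - -K) := fun y => by
        simp only [hf']
        field_simp
        ring
      calc ∫ y, g y ∂μ = ∫ y, (lam * g₁ y - (-(2 * K) * f' y - -K)) ∂μ := by simp only [← hpt]
        _ = _ := by
          rw [integral_sub_sub_const (i1.const_mul _) (i2.const_mul _), integral_const_mul,
            integral_const_mul]
          ring
    rw [h1, h2, hsplit _ (hd.integrable_pow hlam t x), hsplit _ hVπ, hw]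
    have h8 := abs_le.1 (ih hg₁m hg₁V)
    have h9 := abs_le.1 (hT t f' hf'm hf'01)
    rw [abs_le]
    constructor <;> nlinarith

lemma tvDist_le {μ μ' : Measure X} [IsFiniteMeasure μ] [IsFiniteMeasure μ'] {a : ℝ}
    (h : ∀ f : X → ℝ, Measurable f → (∀ y, f y ∈ Set.Icc (0 : ℝ) 1) →
      |∫ y, f y ∂μ - ∫ y, f y ∂μ'| ≤ a) : tvDist μ μ' ≤ a := by
  have : Nonempty {S : Set X // MeasurableSet S} := ⟨⟨∅, .empty⟩⟩
  refine ciSup_le fun ⟨S, hS⟩ => ?_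
  have h1 := h (S.indicator 1) (measurable_one.indicator hS) fun y => by
    by_cases hy : y ∈ S <;> simp [hy]
  rwa [integral_indicator_one hS, integral_indicator_one hS] at h1

lemma vDist_le {μ μ' : Measure X} {a : ℝ}
    (h : ∀ f : X → ℝ, Measurable f → (∀ y, |f y| ≤ V y) →
      |∫ y, f y ∂μ - ∫ y, f y ∂μ'| ≤ a) : vDist V μ μ' ≤ (a : EReal) :=
  iSup_le fun f => EReal.coe_le_coe_iff.2 (h f.1 f.2.1 f.2.2)

end Convergence

end DriftMinorization

theorem theorem4p1 {X : Type*} [MeasurableSpace X]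
    (P : Kernel X X) [IsMarkovKernel P] (π : Measure X) [IsProbabilityMeasure π]
    (hrev : Kernel.IsReversible P π)
    (hspec : DriftMinorization.HasNonnegEigenvalues P π hrev)
    (C : Set X) (V : X → ℝ) (lam K : ℝ) (hlam : 0 < lam)
    (hdrift : DriftMinorization.IsDriftFunction P C V lam K)
    (ν : Measure X) (m : ℕ) (ε : ℝ)
    (hsmall : DriftMinorization.IsSmallSet P C ν m ε) :
    DriftMinorization.rho lam K m ε < 1 ∧
    (∀ (x : X) (t : ℕ), DriftMinorization.tvDist ((P ^ t) x) π ≤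
      (DriftMinorization.F₁ V lam K m ε x * t + DriftMinorization.F₀ V lam K m ε x) *
        DriftMinorization.rho lam K m ε ^ t) ∧
    Integrable V π ∧ (∀ (x : X) (t : ℕ), Integrable V ((P ^ t) x)) ∧
    (DriftMinorization.rho lam K m ε = lam → ∀ (x : X) (t : ℕ),
      DriftMinorization.vDist V ((P ^ t) x) π ≤
        (((DriftMinorization.G₂ V lam K m ε x * (t : ℝ) ^ 2 +
          DriftMinorization.G₁ V lam K m ε x * t + DriftMinorization.G₀ V lam K x) *
            lam ^ t : ℝ) : EReal)) ∧
    (lam < DriftMinorization.rho lam K m ε → ∀ (x : X) (t : ℕ),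
      DriftMinorization.vDist V ((P ^ t) x) π ≤
        (((DriftMinorization.H₁ V lam K m ε x * t + DriftMinorization.H₀ V lam K m ε x) *
            DriftMinorization.rho lam K m ε ^ t +
          (DriftMinorization.G₀ V lam K x - DriftMinorization.H₀ V lam K m ε x) *
            lam ^ t : ℝ) : EReal)) := by
  have hX : Nonempty X := nonempty_of_isProbabilityMeasure π
  have hlam1 := hdrift.lam_lt_one
  have hinv := hrev.invariant
  obtain ⟨x₀, hx₀⟩ := hdrift.nonempty_set hlam
  have htv := fun (x : X) (t : ℕ) (f : X → ℝ) (hf : Measurable f)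
    (hf01 : ∀ y, f y ∈ Set.Icc (0 : ℝ) 1) =>
    DriftMinorization.abs_kernelAct_pow_sub_le hrev hspec hlam hdrift hsmall hf hf01 x t
  refine ⟨DriftMinorization.rho_lt_one hlam hlam1 (hdrift.one_le_K hlam) hsmall.one_le_m
    hsmall.eps_pos (hsmall.eps_le_one hx₀), fun x t => DriftMinorization.tvDist_le (htv x t),
    hdrift.integrable_invariant hlam hinv, fun x t => hdrift.integrable_pow hlam t x,
    fun hrho x t => ?_, fun hrho x t => ?_⟩
  · refine DriftMinorization.vDist_le fun f hf hfV =>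
      DriftMinorization.abs_integral_pow_sub_le_of_recursion hlam hdrift hinv x (htv x)
        -- At `rho = lam` the forcing term is resonant with the recursion, which raises the degree
        -- in `t` by one.
        (w := fun t => (DriftMinorization.G₂ V lam K m ε x * (t : ℝ) ^ 2 +
          DriftMinorization.G₁ V lam K m ε x * t + DriftMinorization.G₀ V lam K x) * lam ^ t)
        (by simp) (fun t => ?_) t hf hfV
    simp only [DriftMinorization.G₁, DriftMinorization.G₂, hrho]
    push_cast
    field_simp
    ring
  · refine DriftMinorization.vDist_le fun f hf hfV =>
      DriftMinorization.abs_integral_pow_sub_le_of_recursion hlam hdrift hinv x (htv x)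
        -- A particular solution at rate `rho`, plus the homogeneous solution at rate `lam` that
        -- fits the initial value `G₀`.
        (w := fun t => (DriftMinorization.H₁ V lam K m ε x * t + DriftMinorization.H₀ V lam K m ε x) *
            DriftMinorization.rho lam K m ε ^ t +
          (DriftMinorization.G₀ V lam K x - DriftMinorization.H₀ V lam K m ε x) * lam ^ t)
        (by simp) (fun t => ?_) t hf hfV
    have hne : DriftMinorization.rho lam K m ε - lam ≠ 0 := (sub_pos.2 hrho).ne'
    simp only [DriftMinorization.H₁, DriftMinorization.H₀]
    push_cast
    field_simp
    ring
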